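/- Fix a relational schema (finitely many relation names $R$, each with finitely many attributes $A$) and a possibly infinite, linearly ordered domain $\mathcal U$ of constants, whose elements are stored as binary words so that the order of $\mathcal U$ is the lexicographic order of the words. Fix a finite set $IC$ of denial constraints $\forall\bar x\,\neg(A_1\wedge\dots\wedge A_k\wedge\gamma)$ (the $A_j$ are database atoms, $\gamma$ is a conjunction of comparisons) and a first-order boolean query $Q$; both may contain constants and the built-in comparisons, and are evaluated with the active-domain semantics. Fix also, for every attribute $A$ of every relation $R$, a finite set $C_{R,A}\subseteq\mathcal U$ of values that may be used to restore consistency, independent of the database; the values stored in a database need not belong to these sets. For an instance $D$ (a finite set of ground atoms), an instance $D'$ is obtained from $D$ by attribute changes if $D'=\{R(\mu_R(\bar t)) : R(\bar t)\in D\}$ for functions $\mu_R$ on tuples such that every attribute value of a tuple of $D$ that is changed is replaced by an element of the corresponding set $C_{R,A}$. The cost of the changes is the sum of the weights $w_{R,A}(\text{old value},\text{new value})$ over all changed attribute values of tuples in $D$, and $f(D,D')$ is the least cost of such changes that lead from $D$ to $D'$. Here the weights $w_{R,A}(a,b)$ are real numbers with $w_{R,A}(a,b)>0$ whenever $a\neq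 b$ and $b\in C_{R,A}$, and $w_{R,A}(a,b)=w_{R,A}(a',b)$ whenever $a,a'\notin C_{R,A}$ and $b\in C_{R,A}$ (for instance, $f$ counts the attribute changes if all weights are $1$). An A-repair of $D$ is an instance $D'$ that is obtained from $D$ by attribute changes and satisfies $IC$, and for which $f(D,D')$ is minimal among all such instances. The consistent answer to $Q$ in $D$ is yes if $Q$ is true in every A-repair of $D$. Theorem. For every $m$ the following problem is solvable by a deterministic Turing machine in polynomial time: given an instance $D$ with $D\models IC$ and a sequence $U$ of $m$ actions $\mathrm{change}(R(\bar t),A,a)$, $a\in\mathcal U$, each of which replaces a value $\bar t[A]\in C_{R,A}$, decide whether the consistent answer to $Q$ in the updated instance $U(D)$ is yes. (The machine may depend on the schema, $IC$, $Q$, the sets $C_{R,A}$, the weights and $m$. As $m$ is fixed, the input consists of the original database and a bounded number of further tuples and constants.) -/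

import Mathlib

/-- A relational schema: finitely many relation names, each with an arity.
The attributes of `R` are the positions `Fin (S.arity R)`. -/
structure Schema where
  Rel : Type
  [fintypeRel : Fintype Rel]
  [decEqRel : DecidableEq Rel]
  arity : Rel → ℕ

attribute [instance] Schema.fintypeRel Schema.decEqRel

/-- Tuples of values for the relation `R`. -/
abbrev Schema.Tuple (S : Schema) (V : Type) (R : S.Rel) : Type := Fin (S.arity R) → V

/-- Ground database atoms `R(t)`. -/
abbrev Schema.Fact (S : Schema) (V : Type) : Type := Σ R : S.Rel, S.Tuple V R

/-- Database instances: finite sets of ground atoms. -/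
abbrev Schema.Inst (S : Schema) (V : Type) : Type := Finset (S.Fact V)

/-! ### The first-order language of a schema -/

/-- Terms: one of `n` variables, or a constant of the domain. -/
inductive DBTerm (V : Type) (n : ℕ) : Type where
  | var : Fin n → DBTerm V n
  | const : V → DBTerm V n

namespace DBTerm

variable {V : Type} {n : ℕ}

def eval (ν : Fin n → V) : DBTerm V n → V
  | var x => ν x
  | const c => c

def consts : DBTerm V n → Set V
  | var _ => ∅
  | const c => {c}

end DBTerm

/-- The built-in comparisons (`>` and `≥` are obtained by exchanging the two sides). -/
inductive CompOp : Type where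
  | eq | ne | lt | le

def CompOp.Holds {V : Type} [LinearOrder V] : CompOp → V → V → Prop
  | eq, a, b => a = b
  | ne, a, b => a ≠ b
  | lt, a, b => a < b
  | le, a, b => a ≤ b

/-- First-order formulas with free variables among `n` variables. -/
inductive FOQuery (S : Schema) (V : Type) : ℕ → Type where
  | atom {n : ℕ} (R : S.Rel) (ts : Fin (S.arity R) → DBTerm V n) : FOQuery S V n
  | comp {n : ℕ} (op : CompOp) (s t : DBTerm V n) : FOQuery S V n
  | not {n : ℕ} (φ : FOQuery S V n) : FOQuery S V n
  | and {n : ℕ} (φ ψ : FOQuery S V n) : FOQuery S V n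
  | all {n : ℕ} (φ : FOQuery S V (n + 1)) : FOQuery S V n

namespace FOQuery

variable {S : Schema} {V : Type}

/-- The constants that occur in a formula. -/
def consts : {n : ℕ} → FOQuery S V n → Set V
  | _, atom _ ts => ⋃ i, (ts i).consts
  | _, comp _ s t => s.consts ∪ t.consts
  | _, not φ => φ.consts
  | _, and φ ψ => φ.consts ∪ ψ.consts
  | _, all φ => φ.consts

/-- Truth of a formula in `D` under the assignment `ν`, with quantifiers ranging over `A`. -/
def Holds [LinearOrder V] (D : S.Inst V) (A : Set V) :
    {n : ℕ} → FOQuery S V n → (Fin n → V) → Prop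
  | _, atom R ts, ν => (⟨R, fun i => (ts i).eval ν⟩ : S.Fact V) ∈ D
  | _, comp op s t, ν => op.Holds (s.eval ν) (t.eval ν)
  | _, not φ, ν => ¬ Holds D A φ ν
  | _, and φ ψ, ν => Holds D A φ ν ∧ Holds D A ψ ν
  | _, all φ, ν => ∀ a ∈ A, Holds D A φ (Fin.snoc ν a)

end FOQuery

/-- The values that occur in an instance. -/
def activeDomain {S : Schema} {V : Type} (D : S.Inst V) : Set V :=
  {v | ∃ f ∈ D, ∃ i, f.2 i = v}

/-- Boolean queries are first-order sentences. -/
abbrev BoolQuery (S : Schema) (V : Type) : Type := FOQuery S V 0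

/-- `D ⊨ Q`, with the active-domain semantics: the quantifiers range over the values that occur
in `D` or in `Q`. -/
def BoolQuery.Sat {S : Schema} {V : Type} [LinearOrder V] (D : S.Inst V) (Q : BoolQuery S V) :
    Prop :=
  FOQuery.Holds D (activeDomain D ∪ FOQuery.consts Q) Q Fin.elim0

/-- A denial constraint `∀ x₁ … xₙ ¬ (A₁ ∧ … ∧ Aₖ ∧ γ)`, where the `Aⱼ` are database atoms and
`γ` is a conjunction of comparisons. -/
structure Denial (S : Schema) (V : Type) where
  nvars : ℕ
  atoms : List (Σ R : S.Rel, Fin (S.arity R) → DBTerm V nvars)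
  comps : List (CompOp × DBTerm V nvars × DBTerm V nvars)

namespace Denial

variable {S : Schema} {V : Type}

def consts (κ : Denial S V) : Set V :=
  {v | (∃ a ∈ κ.atoms, ∃ i, v ∈ (a.2 i).consts) ∨
    ∃ c ∈ κ.comps, v ∈ c.2.1.consts ∨ v ∈ c.2.2.consts}

/-- `D ⊨ κ`, with the active-domain semantics. -/
def Sat [LinearOrder V] (D : S.Inst V) (κ : Denial S V) : Prop :=
  ∀ ν : Fin κ.nvars → V, (∀ x, ν x ∈ activeDomain D ∪ κ.consts) →
    ¬ ((∀ a ∈ κ.atoms, (⟨a.1, fun i => (a.2 i).eval ν⟩ : S.Fact V) ∈ D) ∧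
      ∀ c ∈ κ.comps, c.1.Holds (c.2.1.eval ν) (c.2.2.eval ν))

end Denial

/-- `D ⊨ IC`. -/
def Consistent {S : Schema} {V : Type} [LinearOrder V] (IC : List (Denial S V)) (D : S.Inst V) :
    Prop :=
  ∀ κ ∈ IC, κ.Sat D

/-! ### Updates -/

/-- The update action `change(R(t), A, a)`. -/
structure ChangeAction (S : Schema) (V : Type) where
  rel : S.Rel
  tuple : S.Tuple V rel
  attr : Fin (S.arity rel)
  value : V

/-- The effect of `change(R(t), A, a)`: if `R(t)` is stored, its value at `A` becomes `a`. -/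
def ChangeAction.apply {S : Schema} {V : Type} [DecidableEq V] (u : ChangeAction S V)
    (D : S.Inst V) : S.Inst V :=
  if (⟨u.rel, u.tuple⟩ : S.Fact V) ∈ D then
    insert ⟨u.rel, Function.update u.tuple u.attr u.value⟩ (D.erase ⟨u.rel, u.tuple⟩)
  else D

/-- `U(D)`: the actions of `U` are executed one after the other. -/
def applyUpdates {S : Schema} {V : Type} [DecidableEq V] (U : List (ChangeAction S V))
    (D : S.Inst V) : S.Inst V :=
  U.foldl (fun D u => u.apply D) D

/-! ### Attribute-based repairs -/

section Repairs

variable {S : Schema} {V : Type} [LinearOrder V]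

/-- A simultaneous change of attribute values, relation by relation. -/
abbrev Modification (S : Schema) (V : Type) : Type :=
  ∀ R : S.Rel, S.Tuple V R → S.Tuple V R

/-- Every attribute value that `μ` changes in `D` is replaced by a value that the bounded domain
`dom R A` of that attribute offers. -/
def Modification.Admissible (dom : ∀ R : S.Rel, Fin (S.arity R) → Finset V) (D : S.Inst V)
    (μ : Modification S V) : Prop :=
  ∀ f ∈ D, ∀ A, μ f.1 f.2 A ≠ f.2 A → μ f.1 f.2 A ∈ dom f.1 A

/-- The instance that results from `D` by the changes `μ`. -/
def Modification.result (μ : Modification S V) (D : S.Inst V) : S.Inst V :=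
  D.image fun f => ⟨f.1, μ f.1 f.2⟩

/-- The sum of the weights `w R A old new` of all the attribute changes that `μ` makes in `D`. -/
noncomputable def Modification.cost (w : ∀ R : S.Rel, Fin (S.arity R) → V → V → ℝ)
    (D : S.Inst V) (μ : Modification S V) : ℝ :=
  ∑ f ∈ D, ∑ A, if μ f.1 f.2 A = f.2 A then 0 else w f.1 A (f.2 A) (μ f.1 f.2 A)

/-- `D'` results from `D` by changes of attribute values in existing tuples. -/
def Reachable (dom : ∀ R : S.Rel, Fin (S.arity R) → Finset V) (D D' : S.Inst V) : Prop :=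
  ∃ μ : Modification S V, μ.Admissible dom D ∧ μ.result D = D'

/-- The aggregated difference `f(D, D')` between `D` and an instance `D'` reachable from it: the
least cost of changes that lead from `D` to `D'`. -/
noncomputable def attrDist (dom : ∀ R : S.Rel, Fin (S.arity R) → Finset V)
    (w : ∀ R : S.Rel, Fin (S.arity R) → V → V → ℝ) (D D' : S.Inst V) : ℝ :=
  sInf {c | ∃ μ : Modification S V, μ.Admissible dom D ∧ μ.result D = D' ∧ μ.cost w D = c}

/-- `D'` is an A-repair of `D`. -/
def IsARepair (IC : List (Denial S V)) (dom : ∀ R : S.Rel, Fin (S.arity R) → Finset V)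
    (w : ∀ R : S.Rel, Fin (S.arity R) → V → V → ℝ) (D D' : S.Inst V) : Prop :=
  Reachable dom D D' ∧ Consistent IC D' ∧
    ¬ ∃ D'' : S.Inst V, Reachable dom D D'' ∧ Consistent IC D'' ∧
      attrDist dom w D D'' < attrDist dom w D D'

/-- The consistent answer to `Q` in `D` is yes. -/
def ConsistentAnswerYes (IC : List (Denial S V)) (dom : ∀ R : S.Rel, Fin (S.arity R) → Finset V)
    (w : ∀ R : S.Rel, Fin (S.arity R) → V → V → ℝ) (Q : BoolQuery S V) (D : S.Inst V) : Prop :=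
  ∀ D' : S.Inst V, IsARepair IC dom w D D' → Q.Sat D'

end Repairs

/-! ### Inputs as words, and polynomial time -/

/-- The input alphabet: a letter for each relation name (it opens a stored atom), a letter for
each attribute of a relation (it opens a change action), two bits, and a separator that ends a value. -/
inductive Letter (S : Schema) : Type where
  | rel (R : S.Rel) : Letter S
  | attr (R : S.Rel) (A : Fin (S.arity R)) : Letter S
  | bit (b : Bool) : Letter S
  | sep : Letter S

section Encoding

variable {S : Schema} {V : Type} [LinearOrder V]

def encodeValue (enc : V ↪o List Bool) (v : V) : List (Letter S) :=
  (enc v).map Letter.bit ++ [Letter.sep]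

def encodeTuple (enc : V ↪o List Bool) {k : ℕ} (t : Fin k → V) : List (Letter S) :=
  (List.ofFn t).flatMap (encodeValue enc)

def encodeFact (enc : V ↪o List Bool) (f : S.Fact V) : List (Letter S) :=
  Letter.rel f.1 :: encodeTuple enc f.2

def encodeAction (enc : V ↪o List Bool) (u : ChangeAction S V) : List (Letter S) :=
  Letter.attr u.rel u.attr :: (encodeTuple enc u.tuple ++ encodeValue enc u.value)

/-- An input of incremental consistent query answering: a consistent instance `D`, presented as
a list of its atoms in an arbitrary order (repetitions are harmless), and a sequence of `m` change actions, each of which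
replaces a value of the bounded domain (by an arbitrary value). -/
structure IncrInput (S : Schema) (V : Type) [LinearOrder V] (IC : List (Denial S V))
    (dom : ∀ R : S.Rel, Fin (S.arity R) → Finset V) (m : ℕ) where
  atoms : List (S.Fact V)
  updates : List (ChangeAction S V)
  consistent : Consistent IC atoms.toFinset
  length_updates : updates.length = m
  replaces_dom : ∀ u ∈ updates, u.tuple u.attr ∈ dom u.rel u.attr

def encodeInput (enc : V ↪o List Bool) {IC : List (Denial S V)}
    {dom : ∀ R : S.Rel, Fin (S.arity R) → Finset V} {m : ℕ} (x : IncrInput S V IC dom m) :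
    List (Letter S) :=
  x.atoms.flatMap (encodeFact enc) ++ x.updates.flatMap (encodeAction enc)

end Encoding

open Classical in
/-- A Turing machine decides `P`, in time polynomial in the length of the encoded input. -/
def InPTime {α Γ : Type} (enc : α → List Γ) (P : α → Prop) : Prop :=
  Nonempty (Turing.TM2ComputableInPolyTime enc Computability.encodeBool fun a => decide (P a))

/-! The mathematical core is a bound on the size of the relevant changes. Every update replaces a
value of a bounded domain, so the old value may be restored, and restoring all of them is an
admissible modification with at most `m` changes (`exists_undo`). Updates may merge tuples, so the
result is in general only a subset of the original `D`; since denial constraints are inherited by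
subsets (`Consistent.mono`), it is still consistent. The weights of proper changes take only
finitely many values, because all old values outside the bounded domain weigh the same; hence they
lie between some `δ > 0` and some `M` (`exists_weight_bounds`). An A-repair therefore costs at most
`m * M`, and changes that realize it affect at most `m * M / δ` values. So there is a constant `K`,
independent of the database, such that the consistent answer depends only on optimal replacements of
at most `K` tuples (`exists_consistentAnswerYes_iff`).

That condition is a first-order statement with a fixed number of quantifiers. The old values in a
replacement occur in the updated instance, and the new ones are old values or constants, so every
quantifier ranges over a set of values read off the input. Costs are real numbers, but as functions
of the replacement they have finitely many values with decidable fibres, so comparing two costs is a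
finite case distinction and needs no arithmetic (`DefinableFun`). This gives
`DefInst.definable_trueAfterOptimalReplacements`; the updated instance itself is handled by
`DefInst.apply`, one action at a time.

For polynomial time, decidable predicates are shown to be closed under boolean operations,
comparisons and bounded quantifiers. The programs are structured stack programs, compiled to
`Turing.TM2` with the step count preserved (`Runs.stepsIn`). A test leaves all its stacks unchanged
and pushes one answer, so tests can be nested freely (`WordTest`). A value is represented by any
word that begins with its encoding; thus a suffix of the input serves as a pointer, and
quantification over stored atoms is a search over the suffixes of the input
(`WordTest.exists_suffix`, `Definable.exists_fact`). -/

/-! ### Structured programs on stacks -/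

/-- Structured programs that manipulate stacks indexed by `K` with letters in `G`. -/
inductive StackProg (K G : Type) : Type where
  | skip : StackProg K G
  | push (k : K) (a : G) : StackProg K G
  | seq (p q : StackProg K G) : StackProg K G
  /-- Pop a letter (if there is one) and continue accordingly. -/
  | pop (k : K) (f : Option G → StackProg K G) : StackProg K G
  /-- Pop letters until the stack is empty or the letter popped last is an end letter, and run the
  body for each of them. -/
  | loop (k : K) (atEnd : G → Bool) (f : G → StackProg K G) : StackProg K G

namespace StackProg

variable {K G : Type}

section Semantics

variable [DecidableEq K]

/-- Big-step semantics: `Runs p s s' t` says that `p` leads from `s` to `s'` in `t` steps. -/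
inductive Runs : StackProg K G → (K → List G) → (K → List G) → ℕ → Prop where
  | skip (s : K → List G) : Runs skip s s 1
  | push (s : K → List G) (k : K) (a : G) :
      Runs (push k a) s (Function.update s k (a :: s k)) 1
  | seq {p q : StackProg K G} {s s' s'' : K → List G} {t t' : ℕ} :
      Runs p s s' t → Runs q s' s'' t' → Runs (seq p q) s s'' (t + t')
  | pop {k : K} {f : Option G → StackProg K G} {s s' : K → List G} {t : ℕ} :
      Runs (f (s k).head?) (Function.update s k (s k).tail) s' t → Runs (pop k f) s s' (1 + t)
  | loop_nil {k : K} {atEnd : G → Bool} {f : G → StackProg K G} {s : K → List G} :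
      s k = [] → Runs (loop k atEnd f) s s 1
  | loop_exit {k : K} {atEnd : G → Bool} {f : G → StackProg K G} {s s' : K → List G} {t : ℕ}
      {a : G} {l : List G} : s k = a :: l → atEnd a = true →
      Runs (f a) (Function.update s k l) s' t → Runs (loop k atEnd f) s s' (1 + t)
  | loop_go {k : K} {atEnd : G → Bool} {f : G → StackProg K G} {s s' s'' : K → List G} {t t' : ℕ}
      {a : G} {l : List G} : s k = a :: l → atEnd a = false →
      Runs (f a) (Function.update s k l) s' t → Runs (loop k atEnd f) s' s'' t' →
      Runs (loop k atEnd f) s s'' (1 + t + t')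

end Semantics

/-! ### Compilation to stack machines -/

/-- The labels of the machine that executes a program. -/
def Lab : StackProg K G → Type
  | skip => Unit
  | push _ _ => Unit
  | seq p q => Lab p ⊕ Lab q
  | pop _ f => Unit ⊕ Σ o, Lab (f o)
  | loop _ _ f => Unit ⊕ Σ a, Lab (f a)

/-- The label at which the execution of a program starts. -/
def entry : (p : StackProg K G) → p.Lab
  | skip => ()
  | push _ _ => ()
  | seq p _ => Sum.inl p.entry
  | pop _ _ => Sum.inl ()
  | loop _ _ _ => Sum.inl ()

instance finite_lab [Finite G] : (p : StackProg K G) → Finite p.Lab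
  | skip => inferInstanceAs (Finite Unit)
  | push _ _ => inferInstanceAs (Finite Unit)
  | seq p q =>
    have := finite_lab p
    have := finite_lab q
    inferInstanceAs (Finite (p.Lab ⊕ q.Lab))
  | pop _ f =>
    have := fun o => finite_lab (f o)
    inferInstanceAs (Finite (Unit ⊕ Σ o, (f o).Lab))
  | loop _ _ f =>
    have := fun o => finite_lab (f o)
    inferInstanceAs (Finite (Unit ⊕ Σ o, (f o).Lab))

/-- The alphabets of the compiled machine: there is an additional stack of bits for the output. -/
abbrev Alph (K G : Type) : Option K → Type
  | none => Bool
  | some _ => G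

/-- The statements at the labels of a program that is embedded into a machine by `emb` and followed
by the statement at `exit`. -/
def code {Λ : Type} : (p : StackProg K G) → (p.Lab → Λ) → Λ → p.Lab →
    Turing.TM2.Stmt (Alph K G) Λ (Option G)
  | skip, _, exit, _ => .goto fun _ => exit
  | push k a, _, exit, _ => .push (some k) (fun _ => a) (.goto fun _ => exit)
  | seq p q, emb, _, Sum.inl l =>
      p.code (fun l => emb (Sum.inl l)) (emb (Sum.inr q.entry)) l
  | seq _ q, emb, exit, Sum.inr l => q.code (fun l => emb (Sum.inr l)) exit l
  | pop k f, emb, _, Sum.inl _ =>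
      .pop (some k) (fun _ o => o) (.goto fun o => emb (Sum.inr ⟨o, (f o).entry⟩))
  | pop _ f, emb, exit, Sum.inr ⟨o, l⟩ => (f o).code (fun l => emb (Sum.inr ⟨o, l⟩)) exit l
  | loop k _ f, emb, exit, Sum.inl _ =>
      .pop (some k) (fun _ o => o) (.goto fun o =>
        o.elim exit fun a => emb (Sum.inr ⟨a, (f a).entry⟩))
  | loop _ atEnd f, emb, exit, Sum.inr ⟨a, l⟩ =>
      (f a).code (fun l => emb (Sum.inr ⟨a, l⟩)) (if atEnd a then exit else emb (Sum.inl ())) l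

/-- The stacks of the compiled machine. -/
def fullStacks (s : K → List G) : ∀ k : Option K, List (Alph K G k)
  | none => []
  | some k => s k

/-- The stacks of the compiled machine when it halts with the output `l`. -/
def outStacks (l : List Bool) : ∀ k : Option K, List (Alph K G k)
  | none => l
  | some _ => []

/-! ### Correctness of the compilation -/

section Correctness

variable [DecidableEq K]

theorem update_fullStacks (s : K → List G) (k : K) (l : List G) :
    Function.update (fullStacks s) (some k) l = fullStacks (Function.update s k l) := by
  funext o
  cases o with
  | none => simp [fullStacks]
  | some j =>
    by_cases h : j = k
    · subst h; simp [fullStacks]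
    · have : (some j : Option K) ≠ some k := by simpa using h
      rw [Function.update_of_ne this]
      simp [fullStacks, Function.update_of_ne h]

/-- `t` steps of a machine lead from one configuration to another. -/
def StepsIn {C : Type} (step : C → Option C) (t : ℕ) (c c' : C) : Prop :=
  (flip bind step)^[t] (some c) = some c'

theorem StepsIn.trans {C : Type} {step : C → Option C} {t t' : ℕ} {c c' c'' : C}
    (h : StepsIn step t c c') (h' : StepsIn step t' c' c'') : StepsIn step (t + t') c c'' := by
  unfold StepsIn at *
  rw [add_comm, Function.iterate_add_apply, h, h']

theorem StepsIn.single {C : Type} {step : C → Option C} {c c' : C} (h : step c = some c') :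
    StepsIn step 1 c c' := by
  simpa [StepsIn, flip] using h

theorem step_of_eq {Λ : Type} {M : Λ → Turing.TM2.Stmt (Alph K G) Λ (Option G)} {l : Λ}
    {q : Turing.TM2.Stmt (Alph K G) Λ (Option G)} (h : M l = q) (v : Option G)
    (S : ∀ k, List (Alph K G k)) :
    Turing.TM2.step M ⟨some l, v, S⟩ = some (Turing.TM2.stepAux q v S) := by
  rw [Turing.TM2.step, h]

theorem stepAux_pop_goto {Λ : Type} (k : K) (g : Option G → Λ) (v : Option G) (s : K → List G) :
    Turing.TM2.stepAux (Γ := Alph K G) (.pop (some k) (fun _ o => o) (.goto g)) v (fullStacks s) =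
      ⟨some (g (s k).head?), (s k).head?, fullStacks (Function.update s k (s k).tail)⟩ := by
  rw [← update_fullStacks]
  rfl

/-- Each unit of the big-step count is one machine step. The register may be arbitrary on entry,
since compiled code consults it only right after a pop has overwritten it; a letter that has to be
remembered is kept in the label. -/
theorem Runs.stepsIn {Λ : Type} {M : Λ → Turing.TM2.Stmt (Alph K G) Λ (Option G)}
    {p : StackProg K G} {s s' : K → List G} {t : ℕ} (h : Runs p s s' t) :
    ∀ (emb : p.Lab → Λ) (exit : Λ), (∀ l, M (emb l) = p.code emb exit l) → ∀ v, ∃ v',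
      StepsIn (Turing.TM2.step M) t ⟨some (emb p.entry), v, fullStacks s⟩
        ⟨some exit, v', fullStacks s'⟩ := by
  induction h with
  | skip s =>
    intro emb exit hM v
    exact ⟨v, StepsIn.single (step_of_eq (hM ()) _ _)⟩
  | push s k a =>
    intro emb exit hM v
    refine ⟨v, StepsIn.single ((step_of_eq (hM ()) _ _).trans ?_)⟩
    rw [← update_fullStacks]
    rfl
  | @seq p q s s' s'' t t' _ _ ih₁ ih₂ =>
    intro emb exit hM v
    obtain ⟨v₁, h₁⟩ := ih₁ (fun l => emb (Sum.inl l)) (emb (Sum.inr q.entry))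
      (fun l => hM (Sum.inl l)) v
    obtain ⟨v₂, h₂⟩ := ih₂ (fun l => emb (Sum.inr l)) exit (fun l => hM (Sum.inr l)) v₁
    exact ⟨v₂, h₁.trans h₂⟩
  | @pop k f s s' t _ ih =>
    intro emb exit hM v
    obtain ⟨v₁, h₁⟩ := ih (fun l => emb (Sum.inr ⟨_, l⟩)) exit
      (fun l => hM (Sum.inr ⟨_, l⟩)) (s k).head?
    exact ⟨v₁, StepsIn.trans (StepsIn.single ((step_of_eq (hM (Sum.inl ())) _ _).trans
      (congrArg some (stepAux_pop_goto k _ v s)))) h₁⟩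
  | @loop_nil k atEnd f s hs =>
    intro emb exit hM v
    refine ⟨none, StepsIn.single ((step_of_eq (hM (Sum.inl ())) _ _).trans
      (congrArg some ((stepAux_pop_goto k _ v s).trans ?_)))⟩
    rw [hs, List.tail_nil, ← hs, Function.update_eq_self, hs]
    rfl
  | @loop_exit k atEnd f s s' t a l hs ha _ ih =>
    intro emb exit hM v
    obtain ⟨v₁, h₁⟩ := ih (fun l => emb (Sum.inr ⟨_, l⟩)) exit
      (fun l => (hM (Sum.inr ⟨_, l⟩)).trans (by simp [code, ha])) (some a)
    refine ⟨v₁, StepsIn.trans (StepsIn.single ((step_of_eq (hM (Sum.inl ())) _ _).trans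
      (congrArg some ((stepAux_pop_goto k _ v s).trans ?_)))) h₁⟩
    rw [hs]
    rfl
  | @loop_go k atEnd f s s' s'' t t' a l hs ha _ _ ih₁ ih₂ =>
    intro emb exit hM v
    obtain ⟨v₁, h₁⟩ := ih₁ (fun l => emb (Sum.inr ⟨_, l⟩)) (emb (Sum.inl ()))
      (fun l => (hM (Sum.inr ⟨_, l⟩)).trans (by simp [code, ha])) (some a)
    obtain ⟨v₂, h₂⟩ := ih₂ emb exit hM v₁
    refine ⟨v₂, StepsIn.trans (StepsIn.trans (StepsIn.single
      ((step_of_eq (hM (Sum.inl ())) _ _).trans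
      (congrArg some ((stepAux_pop_goto k _ v s).trans ?_)))) h₁) h₂⟩
    rw [hs]
    rfl

end Correctness

/-- The machine that executes `p` and then outputs whether the letter on top of the stack `ans` is
`yes`. -/
noncomputable def machine {n : ℕ} [Finite G] (yes : G) (inp ans : Fin n)
    (p : StackProg (Fin n) G) : Turing.FinTM2 :=
  letI : DecidableEq G := Classical.decEq G
  letI : Fintype G := Fintype.ofFinite G
  letI : Fintype p.Lab := Fintype.ofFinite p.Lab
  { K := Option (Fin n)
    k₀ := some inp
    k₁ := none
    Γ := Alph (Fin n) G
    Λ := Option p.Lab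
    main := some p.entry
    σ := Option G
    initialState := none
    Γk₀Fin := inferInstanceAs (Fintype G)
    m := fun l => l.elim
      (.pop (some ans) (fun _ o => o) <| .push none (fun o => decide (o = some yes)) <|
        .load (fun _ => none) .halt)
      (p.code some none) }

theorem stepAux_output {Λ : Type} [DecidableEq G] {n : ℕ} (yes : G) (ans : Fin n)
    (v : Option G) (b : G) :
    Turing.TM2.stepAux (Γ := Alph (Fin n) G) (Λ := Λ)
      (.pop (some ans) (fun _ o => o) <| .push none (fun o => decide (o = some yes)) <|
        .load (fun _ => none) .halt) v (fullStacks (Function.update (fun _ => []) ans [b])) =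
      ⟨none, none, outStacks [decide (b = yes)]⟩ := by
  simp only [Turing.TM2.stepAux]
  congr 1
  funext k
  cases k with
  | none => simp [fullStacks, outStacks]
  | some k =>
    rw [Function.update_of_ne (by simp), update_fullStacks]
    by_cases hk : k = ans <;> simp [fullStacks, outStacks, fullStacks, hk]

/-- A halting configuration with an output has every other stack empty and the register in its
initial state. Therefore the run has to end with nothing but the answer letter, which the last step
turns into the output bit; this step accounts for the summand 1 in `T + 1`. -/
theorem inPTime_of_runs {α : Type} [Finite G] {n : ℕ} {yes : G}
    {inp ans : Fin n} (p : StackProg (Fin n) G) (enc : α → List G) (P : α → Prop)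
    (T : Polynomial ℕ)
    (h : ∀ x, ∃ t ≤ T.eval (enc x).length, ∃ b, (b = yes ↔ P x) ∧
      Runs p (Function.update (fun _ => []) inp (enc x)) (Function.update (fun _ => []) ans [b]) t) :
    InPTime enc P := by
  classical
  refine ⟨⟨⟨machine yes inp ans p, Equiv.refl G, Equiv.refl Bool⟩, T + 1, fun x => ?_⟩⟩
  refine Classical.choice ?_
  obtain ⟨t, ht, b, hbP, hrun⟩ := h x
  obtain ⟨v, hv⟩ := hrun.stepsIn (M := (machine yes inp ans p).m) some none (fun l => rfl) none
  have hlast := StepsIn.single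
    ((step_of_eq (M := (machine yes inp ans p).m) (l := none) rfl v _).trans
      (congrArg some (@stepAux_output G _ (Classical.decEq G) n yes ans v b)))
  have hhalt : Turing.haltList (machine yes inp ans p)
      (List.map id [decide (P x)]) =
      ⟨none, none, outStacks [@decide (b = yes) (Classical.decEq G b yes)]⟩ := by
    unfold Turing.haltList
    refine congrArg (Turing.TM2.Cfg.mk none none) ?_
    funext k
    cases k with
    | none =>
      simp only [machine, List.map_id, dite_true, hbP]
      rfl
    | some k => exact dif_neg (by simp [machine])
  have hinit : Turing.initList (machine yes inp ans p) (List.map id (enc x)) =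
      ⟨some (some p.entry), none, fullStacks (Function.update (fun _ => []) inp (enc x))⟩ := by
    unfold Turing.initList
    refine congrArg (Turing.TM2.Cfg.mk (some (some p.entry)) none) ?_
    funext k
    cases k with
    | none => simp [fullStacks, machine]
    | some k =>
      by_cases hk : k = inp
      · subst hk
        simp only [fullStacks, machine, List.map_id, Function.update_self, dite_true]
        rfl
      · simp [fullStacks, machine, hk]
  refine ⟨⟨⟨t + 1, ?_⟩, by simpa using ht⟩⟩
  have hall : _ = _ := hv.trans hlast
  refine Eq.trans ?_ (Eq.trans hall (congrArg some hhalt.symm))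
  exact congrArg (fun c => (flip bind (Turing.TM2.step (machine yes inp ans p).m))^[t + 1] (some c))
    hinit

end StackProg

/-! ### Running times of basic stack programs -/

namespace StackProg

variable {K G : Type} [DecidableEq K]

theorem update_eq_of_eq {s : K → List G} {k : K} {l : List G} (h : s k = l) :
    Function.update s k l = s := by
  rw [← h, Function.update_eq_self]

/-- `p` leads from `s` to `s'` in at most `T` steps. -/
def RunsIn (p : StackProg K G) (s s' : K → List G) (T : ℕ) : Prop :=
  ∃ t ≤ T, Runs p s s' t

theorem RunsIn.mono {p : StackProg K G} {s s' : K → List G} {T T' : ℕ} (h : RunsIn p s s' T)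
    (hT : T ≤ T') : RunsIn p s s' T' := by
  obtain ⟨t, ht, hr⟩ := h
  exact ⟨t, ht.trans hT, hr⟩

theorem RunsIn.congr {p : StackProg K G} {s s' s'' : K → List G} {T : ℕ} (h : RunsIn p s s' T)
    (hs : s' = s'') : RunsIn p s s'' T := hs ▸ h

theorem runsIn_skip (s : K → List G) : RunsIn skip s s 1 := ⟨1, le_rfl, .skip s⟩

theorem runsIn_push (s : K → List G) (k : K) (a : G) :
    RunsIn (push k a) s (Function.update s k (a :: s k)) 1 := ⟨1, le_rfl, .push s k a⟩

theorem RunsIn.seq {p q : StackProg K G} {s s' s'' : K → List G} {T T' : ℕ}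
    (h : RunsIn p s s' T) (h' : RunsIn q s' s'' T') : RunsIn (p.seq q) s s'' (T + T') := by
  obtain ⟨t, ht, hr⟩ := h
  obtain ⟨t', ht', hr'⟩ := h'
  exact ⟨t + t', add_le_add ht ht', hr.seq hr'⟩

theorem RunsIn.pop {k : K} {f : Option G → StackProg K G} {s s' : K → List G} {T : ℕ}
    (h : RunsIn (f (s k).head?) (Function.update s k (s k).tail) s' T) :
    RunsIn (StackProg.pop k f) s s' (1 + T) := by
  obtain ⟨t, ht, hr⟩ := h
  exact ⟨1 + t, by omega, hr.pop⟩

theorem runsIn_loop_nil {k : K} {atEnd : G → Bool} {f : G → StackProg K G} {s : K → List G}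
    (h : s k = []) : RunsIn (loop k atEnd f) s s 1 := ⟨1, le_rfl, .loop_nil h⟩

theorem RunsIn.loop_exit {k : K} {atEnd : G → Bool} {f : G → StackProg K G} {s s' : K → List G}
    {T : ℕ} {a : G} {l : List G} (hs : s k = a :: l) (ha : atEnd a = true)
    (h : RunsIn (f a) (Function.update s k l) s' T) : RunsIn (loop k atEnd f) s s' (1 + T) := by
  obtain ⟨t, ht, hr⟩ := h
  exact ⟨1 + t, by omega, hr.loop_exit hs ha⟩

theorem RunsIn.loop_go {k : K} {atEnd : G → Bool} {f : G → StackProg K G} {s s' s'' : K → List G}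
    {T T' : ℕ} {a : G} {l : List G} (hs : s k = a :: l) (ha : atEnd a = false)
    (h : RunsIn (f a) (Function.update s k l) s' T) (h' : RunsIn (loop k atEnd f) s' s'' T') :
    RunsIn (loop k atEnd f) s s'' (1 + T + T') := by
  obtain ⟨t, ht, hr⟩ := h
  obtain ⟨t', ht', hr'⟩ := h'
  exact ⟨1 + t + t', by omega, hr.loop_go hs ha hr'⟩

/-! ### Moving words between stacks -/

/-- Run the body for all the letters of a stack. -/
def forAll (k : K) (f : G → StackProg K G) : StackProg K G := loop k (fun _ => false) f

/-- Make a stack empty. -/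
def clear (k : K) : StackProg K G := forAll k fun _ => skip

theorem runsIn_clear (k : K) (s : K → List G) :
    RunsIn (clear k) s (Function.update s k []) ((s k).length * 2 + 1) := by
  generalize hl : s k = l
  induction l generalizing s with
  | nil => exact (runsIn_loop_nil hl).congr (update_eq_of_eq hl).symm
  | cons a l ih =>
    refine (RunsIn.loop_go hl rfl (runsIn_skip _) ((ih _ (by simp)).congr ?_)).mono ?_
    · simp
    · simp; omega

/-- Copy the stack `k` to the empty stack `x` by means of the empty stack `y`. -/
def copy (k x y : K) : StackProg K G :=
  (forAll k fun a => push y a).seq (forAll y fun a => (push k a).seq (push x a))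

theorem runsIn_reverse {k y : K} (hky : k ≠ y) (s : K → List G) :
    RunsIn (forAll k fun a => push y a) s
      (Function.update (Function.update s k []) y ((s k).reverse ++ s y))
      ((s k).length * 2 + 1) := by
  generalize hl : s k = l
  induction l generalizing s with
  | nil => exact (runsIn_loop_nil hl).congr (by simp [update_eq_of_eq hl])
  | cons a l ih =>
    refine (RunsIn.loop_go hl rfl (runsIn_push _ _ _)
      ((ih _ (by simp [hky])).congr ?_)).mono ?_
    · funext z
      by_cases h1 : z = y
      · subst h1; simp [hky.symm]
      · by_cases h2 : z = k
        · subst h2; simp [hky]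
        · simp [h1, h2]
    · simp; omega

theorem runsIn_distribute {k x y : K} (hkx : k ≠ x) (hky : k ≠ y) (hxy : x ≠ y)
    (s : K → List G) :
    RunsIn (forAll y fun a => (push k a).seq (push x a)) s
      (Function.update (Function.update (Function.update s y []) k ((s y).reverse ++ s k)) x
        ((s y).reverse ++ s x)) ((s y).length * 3 + 1) := by
  generalize hl : s y = l
  induction l generalizing s with
  | nil =>
    refine (runsIn_loop_nil hl).congr ?_
    funext z
    by_cases h1 : z = x
    · subst h1; simp
    · by_cases h2 : z = k
      · subst h2; simp [h1]
      · by_cases h3 : z = y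
        · subst h3; simp [h1, h2, hl]
        · simp [h1, h2, h3]
  | cons a l ih =>
    refine (RunsIn.loop_go hl rfl ((runsIn_push _ _ _).seq (runsIn_push _ _ _))
      ((ih _ (by simp [hky.symm, hxy.symm])).congr ?_)).mono ?_
    · funext z
      by_cases h1 : z = x
      · subst h1; simp [hkx.symm, hxy]
      · by_cases h2 : z = k
        · subst h2; simp [hkx, hky]
        · by_cases h3 : z = y
          · subst h3; simp [h1, h2]
          · simp [h1, h2, h3]
    · simp; omega

/-- Moving to `y` reverses the word, and moving back to both `k` and `x` reverses it again. -/
theorem runsIn_copy {k x y : K} (hkx : k ≠ x) (hky : k ≠ y) (hxy : x ≠ y) (s : K → List G)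
    (hx : s x = []) (hy : s y = []) :
    RunsIn (copy k x y) s (Function.update s x (s k)) ((s k).length * 5 + 2) := by
  refine ((runsIn_reverse hky s).seq ((runsIn_distribute hkx hky hxy _).congr ?_)).mono ?_
  · funext z
    by_cases h1 : z = x
    · subst h1; simp [hkx.symm, hxy, hx, hy]
    · by_cases h2 : z = k
      · subst h2; simp [hkx, hky, hy]
      · by_cases h3 : z = y
        · subst h3; simp [h1, h2, hy]
        · simp [h1, h2, h3]
  · simp [hy]; omega

/-- Push a fixed word. -/
def pushWord (k : K) (c : List G) : StackProg K G := c.foldr (fun a p => p.seq (push k a)) skip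

theorem runsIn_pushWord (k : K) (c : List G) (s : K → List G) :
    RunsIn (pushWord k c) s (Function.update s k (c ++ s k)) (c.length + 1) := by
  induction c with
  | nil => exact (runsIn_skip s).congr (by simp)
  | cons a c ih =>
    refine (RunsIn.seq ih (runsIn_push _ _ _)).congr ?_
    simp

/-- Remove the letters of a stack up to the first one that does not satisfy `p`. -/
def dropLetters (k : K) (p : G → Bool) : StackProg K G :=
  loop k (fun a => !p a) fun a => if p a then skip else push k a

theorem runsIn_dropLetters (k : K) (p : G → Bool) (s : K → List G) :
    RunsIn (dropLetters k p) s (Function.update s k ((s k).dropWhile p))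
      ((s k).length * 2 + 1) := by
  generalize hl : s k = l
  induction l generalizing s with
  | nil => exact (runsIn_loop_nil hl).congr (by simp [update_eq_of_eq hl])
  | cons a l ih =>
    by_cases hp : p a = true
    · refine (RunsIn.loop_go hl (by simp [hp]) (s' := Function.update s k l) (T := 1) ?_
        ((ih _ (by simp)).congr ?_)).mono ?_
      · simpa [hp] using runsIn_skip _
      · simp [hp]
      · simp; omega
    -- The loop can inspect the first letter to be kept only by popping it, so this letter is pushed
    -- back.
    · refine (RunsIn.loop_exit hl (by simp [hp]) (s' := s) (T := 1) ?_).congr ?_ |>.mono ?_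
      · simp only [hp]
        exact (runsIn_push _ _ _).congr (by simp [update_eq_of_eq hl])
      · simp [hp, update_eq_of_eq hl]
      · simp; omega

end StackProg

/-! ### Tests on words -/

section WordTests

open StackProg Function

variable {S : Schema}

instance Letter.finite : Finite (Letter S) := by
  have : Function.Surjective (fun x : S.Rel ⊕ (Σ R, Fin (S.arity R)) ⊕ Bool ⊕ Unit =>
      (match x with
      | .inl R => Letter.rel R
      | .inr (.inl p) => Letter.attr p.1 p.2
      | .inr (.inr (.inl b)) => Letter.bit b
      | .inr (.inr (.inr _)) => Letter.sep : Letter S)) := by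
    intro l
    cases l with
    | rel R => exact ⟨.inl R, rfl⟩
    | attr R A => exact ⟨.inr (.inl ⟨R, A⟩), rfl⟩
    | bit b => exact ⟨.inr (.inr (.inl b)), rfl⟩
    | sep => exact ⟨.inr (.inr (.inr ())), rfl⟩
  exact Finite.of_surjective _ this

noncomputable instance Letter.decidableEq : DecidableEq (Letter S) := Classical.decEq _

open Classical in
/-- The letter by which a program reports whether `P` is true. -/
noncomputable def ansLetter (S : Schema) (P : Prop) : Letter S := Letter.bit (decide P)

theorem ansLetter_eq_true {P : Prop} : ansLetter S P = Letter.bit true ↔ P := by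
  simp [ansLetter]

theorem ansLetter_congr {P P' : Prop} (h : P ↔ P') : ansLetter S P = ansLetter S P' := by
  rw [propext h]

theorem ansLetter_true : ansLetter S True = Letter.bit true := by simp [ansLetter]

theorem ansLetter_false : ansLetter S False = Letter.bit false := by simp [ansLetter]

/-- The stacks of a test: the variables `ρ`, the stack `a` for the answer, and `N` auxiliary
stacks `fr`. -/
structure Layout {K ι : Type} (N : ℕ) (ρ : ι → K) (a : K) (fr : ℕ → K) : Prop where
  var_ne_ans : ∀ i, ρ i ≠ a
  aux_ne_ans : ∀ j < N, fr j ≠ a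
  var_ne_aux : ∀ i, ∀ j < N, ρ i ≠ fr j
  aux_inj : ∀ i < N, ∀ j < N, fr i = fr j → i = j

/-- The environment `w`, extended by a further word. -/
def extendEnv {ι α : Type} (w : ι → α) (t : α) : Option ι → α := fun o => o.elim t w

theorem Layout.mono {K ι : Type} {N N' : ℕ} {ρ : ι → K} {a : K} {fr : ℕ → K}
    (h : Layout N ρ a fr) (hN : N' ≤ N) : Layout N' ρ a fr where
  var_ne_ans := h.var_ne_ans
  aux_ne_ans j hj := h.aux_ne_ans j (by omega)
  var_ne_aux i j hj := h.var_ne_aux i j (by omega)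
  aux_inj i hi j hj := h.aux_inj i (by omega) j (by omega)

theorem Layout.comp {K ι κ : Type} {N : ℕ} {ρ : κ → K} {a : K} {fr : ℕ → K}
    (h : Layout N ρ a fr) (f : ι → κ) : Layout N (ρ ∘ f) a fr where
  var_ne_ans _ := h.var_ne_ans _
  aux_ne_ans := h.aux_ne_ans
  var_ne_aux _ := h.var_ne_aux _
  aux_inj := h.aux_inj

theorem Layout.extend {K ι : Type} {N : ℕ} {ρ : ι → K} {a : K} {fr : ℕ → K}
    (h : Layout (N + 1) ρ a fr) :
    Layout N (extendEnv ρ (fr 0)) a (fun j => fr (j + 1)) where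
  var_ne_ans o := by
    cases o with
    | none => exact h.aux_ne_ans 0 (by omega)
    | some i => exact h.var_ne_ans i
  aux_ne_ans j hj := h.aux_ne_ans _ (by omega)
  var_ne_aux o j hj := by
    cases o with
    | none => exact fun e => absurd (h.aux_inj 0 (by omega) (j + 1) (by omega) e) (by omega)
    | some i => exact h.var_ne_aux i _ (by omega)
  aux_inj i hi j hj e := by
    have := h.aux_inj _ (by omega) _ (by omega) e
    omega

/-- There is a program that decides `P`, uses at most `N` auxiliary stacks, and takes at most
`T.eval n` steps if the lengths of the words are at most `n`. -/
def WordTestIn (N : ℕ) (T : Polynomial ℕ) {ι : Type} (P : (ι → List (Letter S)) → Prop) : Prop :=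
  ∀ {K : Type} [DecidableEq K] (ρ : ι → K) (a : K) (fr : ℕ → K), Layout N ρ a fr →
    ∃ p : StackProg K (Letter S), ∀ (s : K → List (Letter S)) (n : ℕ),
      (∀ i, (s (ρ i)).length ≤ n) → (∀ j < N, s (fr j) = []) →
      RunsIn p s (update s a (ansLetter S (P (s ∘ ρ)) :: s a)) (T.eval n)

/-- `P` can be decided by a program in polynomial time. -/
def WordTest {ι : Type} (P : (ι → List (Letter S)) → Prop) : Prop :=
  ∃ N T, WordTestIn N T P

theorem WordTestIn.mono {N N' : ℕ} {T T' : Polynomial ℕ} {ι : Type}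
    {P : (ι → List (Letter S)) → Prop} (h : WordTestIn N T P) (hN : N ≤ N')
    (hT : ∀ n, T.eval n ≤ T'.eval n) : WordTestIn N' T' P := by
  intro K _ ρ a fr hL
  obtain ⟨p, hp⟩ := h ρ a fr (hL.mono hN)
  exact ⟨p, fun s n hn hs => (hp s n hn fun j hj => hs j (by omega)).mono (hT n)⟩

/-- A program that branches on a letter contains one test for each letter; common bounds on stacks
and time exist because the alphabet is finite. -/
theorem WordTest.uniform {α : Type} [Finite α] {ι : Type}
    {P : α → (ι → List (Letter S)) → Prop} (h : ∀ x, WordTest (P x)) :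
    ∃ N T, ∀ x, WordTestIn N T (P x) := by
  cases nonempty_fintype α
  choose N T hNT using h
  refine ⟨∑ x, N x, ∑ x, T x, fun x => WordTestIn.mono (hNT x) ?_ fun n => ?_⟩
  · exact Finset.single_le_sum (f := N) (fun _ _ => Nat.zero_le _) (Finset.mem_univ x)
  · rw [Polynomial.eval_finsetSum]
    exact Finset.single_le_sum (f := fun x => (T x).eval n) (fun _ _ => Nat.zero_le _)
      (Finset.mem_univ x)

theorem WordTest.congr {ι : Type} {P P' : (ι → List (Letter S)) → Prop} (h : WordTest P)
    (hP : ∀ w, P w ↔ P' w) : WordTest P' := by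
  have : P = P' := funext fun w => propext (hP w)
  exact this ▸ h

/-- A layout does not require `ρ` to be injective. Several variables may share a stack, so
identifying or permuting variables takes no copying. -/
theorem WordTest.rename {ι κ : Type} {P : (ι → List (Letter S)) → Prop} (h : WordTest P)
    (f : ι → κ) : WordTest fun w : κ → List (Letter S) => P (w ∘ f) := by
  obtain ⟨N, T, h⟩ := h
  refine ⟨N, T, fun ρ a fr hL => ?_⟩
  obtain ⟨p, hp⟩ := h (ρ ∘ f) a fr (hL.comp f)
  exact ⟨p, fun s n hn hs => hp s n (fun i => hn _) hs⟩

theorem wordTest_const {ι : Type} (c : Prop) :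
    WordTest fun _ : ι → List (Letter S) => c :=
  ⟨0, 1, fun _ a _ _ => ⟨push a (ansLetter S c), fun s n _ _ => by
    simpa using runsIn_push s a (ansLetter S c)⟩⟩

open Classical in
theorem WordTest.ite {ι : Type} {P Q R : (ι → List (Letter S)) → Prop} (hP : WordTest P)
    (hQ : WordTest Q) (hR : WordTest R) : WordTest fun w => if P w then Q w else R w := by
  obtain ⟨N₁, T₁, h₁⟩ := hP
  obtain ⟨N₂, T₂, h₂⟩ := hQ
  obtain ⟨N₃, T₃, h₃⟩ := hR
  -- The three tests reuse the same auxiliary stacks, which each test returns empty; the sum merely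
  -- serves as a common upper bound.
  refine ⟨N₁ + N₂ + N₃, T₁ + (1 + (T₂ + T₃)), fun ρ a fr hL => ?_⟩
  obtain ⟨p, hp⟩ := h₁ ρ a fr (hL.mono (by omega))
  obtain ⟨q, hq⟩ := h₂ ρ a fr (hL.mono (by omega))
  obtain ⟨r, hr⟩ := h₃ ρ a fr (hL.mono (by omega))
  refine ⟨p.seq (.pop a fun o => if o = some (.bit true) then q else r), fun s n hn hs => ?_⟩
  have hp := hp s n hn fun j hj => hs j (by omega)
  have hq := hq s n hn fun j hj => hs j (by omega)
  have hr := hr s n hn fun j hj => hs j (by omega)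
  simp only [Polynomial.eval_add, Polynomial.eval_one]
  refine hp.seq (.pop ?_)
  simp only [update_self, List.head?_cons, List.tail_cons, update_idem, update_eq_self,
    Option.some.injEq, ansLetter_eq_true]
  by_cases h : P (s ∘ ρ)
  · simp only [h, if_true]
    exact hq.mono (by omega)
  · simp only [h, if_false]
    exact hr.mono (by omega)

theorem WordTest.not {ι : Type} {P : (ι → List (Letter S)) → Prop} (h : WordTest P) :
    WordTest fun w => ¬ P w :=
  (h.ite (wordTest_const False) (wordTest_const True)).congr fun w => by
    by_cases hw : P w <;> simp [hw]

theorem WordTest.and {ι : Type} {P Q : (ι → List (Letter S)) → Prop} (h : WordTest P)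
    (h' : WordTest Q) : WordTest fun w => P w ∧ Q w :=
  (h.ite h' (wordTest_const False)).congr fun w => by
    by_cases hw : P w <;> simp [hw]

theorem comp_extend_update {K ι : Type} [DecidableEq K] {N : ℕ} {ρ : ι → K} {a : K} {fr : ℕ → K}
    (hL : Layout (N + 1) ρ a fr) (s : K → List (Letter S)) (t : List (Letter S)) :
    update s (fr 0) t ∘ extendEnv ρ (fr 0) = extendEnv (s ∘ ρ) t := by
  funext o
  cases o with
  | none => simp [extendEnv]
  | some i => simp [extendEnv, hL.var_ne_aux i 0 (by omega)]

theorem length_extend_le {K ι : Type} [DecidableEq K] {N : ℕ} {ρ : ι → K} {a : K} {fr : ℕ → K}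
    (hL : Layout (N + 1) ρ a fr) {s : K → List (Letter S)} {t : List (Letter S)} {n : ℕ}
    (hn : ∀ i, (s (ρ i)).length ≤ n) (ht : t.length ≤ n) (o : Option ι) :
    (update s (fr 0) t (extendEnv ρ (fr 0) o)).length ≤ n := by
  have := congrFun (comp_extend_update hL s t) o
  simp only [comp_apply] at this
  rw [this]
  cases o with
  | none => exact ht
  | some i => exact hn i

theorem aux_update_eq_nil {K ι : Type} [DecidableEq K] {N : ℕ} {ρ : ι → K} {a : K} {fr : ℕ → K}
    (hL : Layout (N + 1) ρ a fr) {s : K → List (Letter S)} (t : List (Letter S))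
    (hs : ∀ j < N + 1, s (fr j) = []) {j : ℕ} (hj : j < N) :
    update s (fr 0) t (fr (j + 1)) = [] := by
  rw [update_of_ne, hs _ (by omega)]
  exact fun e => absurd (hL.aux_inj _ (by omega) _ (by omega) e) (by omega)

theorem WordTest.const {ι : Type} {Q : (Option ι → List (Letter S)) → Prop} (h : WordTest Q)
    (c : List (Letter S)) : WordTest fun w => Q (extendEnv w c) := by
  obtain ⟨N, T, h⟩ := h
  -- The constant is a further word of the inner test and may be longer than the others, hence the
  -- argument of `T` is shifted by its length.
  refine ⟨N + 1, (c.length + 1 : ℕ) + (T.comp (.X + (c.length : ℕ)) + (c.length * 2 + 1 : ℕ)),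
    fun ρ a fr hL => ?_⟩
  obtain ⟨p, hp⟩ := h _ a _ hL.extend
  refine ⟨(pushWord (fr 0) c).seq (p.seq (clear (fr 0))), fun s n hn hs => ?_⟩
  have ha := hL.aux_ne_ans 0 (by omega)
  have hp := hp (update s (fr 0) c) (n + c.length)
    (length_extend_le hL (fun i => (hn i).trans (by omega)) (by omega))
    (fun j hj => aux_update_eq_nil hL c hs hj)
  rw [comp_extend_update hL] at hp
  simp only [Polynomial.eval_add, Polynomial.eval_natCast, Polynomial.eval_comp, Polynomial.eval_X]
  refine ((runsIn_pushWord _ _ _).congr (by rw [hs 0 (by omega), List.append_nil])).seq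
    (hp.seq (((runsIn_clear _ _).congr ?_).mono ?_))
  · rw [update_of_ne ha.symm, update_comm ha.symm, update_idem,
      update_eq_of_eq (hs 0 (by omega))]
  · simp [ha]

/-- The remainder of a word after the first letter that does not satisfy `p`, and this letter, are
available to further tests. -/
theorem WordTest.dropWhile {ι : Type} {Q : Option (Letter S) → (Option ι → List (Letter S)) → Prop}
    (h : ∀ o, WordTest (Q o)) (p : Letter S → Bool) (i : ι) :
    WordTest fun w => Q ((w i).dropWhile p).head? (extendEnv w ((w i).dropWhile p).tail) := by
  obtain ⟨N, T, h⟩ := WordTest.uniform h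
  refine ⟨N + 2, (.X * 5 + 2) + ((.X * 2 + 1) + (1 + (T + (.X * 2 + 1)))), fun ρ a fr hL => ?_⟩
  choose q hq using fun o => h o _ a _ (hL.mono (N' := N + 1) (by omega)).extend
  refine ⟨(copy (ρ i) (fr 0) (fr 1)).seq ((dropLetters (fr 0) p).seq
    (.pop (fr 0) fun o => (q o).seq (clear (fr 0)))), fun s n hn hs => ?_⟩
  have hL' := hL.mono (N' := N + 1) (by omega)
  have ha := hL.aux_ne_ans 0 (by omega)
  have h01 : fr 0 ≠ fr 1 := fun e => absurd (hL.aux_inj 0 (by omega) 1 (by omega) e) (by omega)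
  set l := (s (ρ i)).dropWhile p with hl
  have hlen : l.tail.length ≤ n := by
    have : l.length ≤ _ := (List.dropWhile_suffix (l := s (ρ i)) p).length_le
    have := hn i
    rw [List.length_tail]
    omega
  have hq := hq l.head? (update s (fr 0) l.tail) n (length_extend_le hL' hn hlen)
    (fun j hj => aux_update_eq_nil hL' _ (fun j hj => hs j (by omega)) hj)
  rw [comp_extend_update hL'] at hq
  simp only [Polynomial.eval_add, Polynomial.eval_one, Polynomial.eval_mul, Polynomial.eval_X,
    Polynomial.eval_ofNat]
  refine ((runsIn_copy (hL.var_ne_aux i 0 (by omega)) (hL.var_ne_aux i 1 (by omega)) h01 s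
    (hs 0 (by omega)) (hs 1 (by omega))).mono ?_).seq
    ((((runsIn_dropLetters (fr 0) p _).congr (s'' := update s (fr 0) l) ?_).mono ?_).seq
      (.pop (T := T.eval n + (n * 2 + 1)) ?_))
  · have := hn i; omega
  · simp [hl]
  · have := hn i; simp; omega
  · rw [update_self, update_idem]
    refine hq.seq (((runsIn_clear (fr 0) _).congr ?_).mono ?_)
    · rw [update_of_ne ha.symm, update_comm ha.symm, update_idem,
        update_eq_of_eq (hs 0 (by omega))]
      rfl
    · rw [update_of_ne ha, update_self]; omega

/-- Replace the two answers on top of a stack by their disjunction. -/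
noncomputable def accumulate {K : Type} (a : K) : StackProg K (Letter S) :=
  .pop a fun o => if o = some (.bit true) then
    (StackProg.pop a fun _ => skip).seq (push a (.bit true)) else skip

theorem runsIn_accumulate {K : Type} [DecidableEq K] {a : K} {s : K → List (Letter S)}
    {P Q : Prop} {l : List (Letter S)} (h : s a = ansLetter S P :: ansLetter S Q :: l) :
    RunsIn (accumulate a) s (update s a (ansLetter S (Q ∨ P) :: l)) 4 := by
  refine RunsIn.pop (T := 3) ?_
  rw [h]
  by_cases hP : P
  · simp only [hP, ansLetter_true, List.head?_cons, if_true, or_true]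
    refine (RunsIn.pop (T := 1) (f := fun _ => skip) (runsIn_skip _)).seq
      ((runsIn_push _ _ _).congr ?_)
    simp
  · simp only [List.head?_cons, Option.some.injEq, ansLetter_eq_true, hP, if_false, or_false]
    exact (runsIn_skip _).mono (by omega)

/-- Bounded search for a suffix of a word. -/
theorem WordTest.exists_suffix {ι : Type} {Q : Letter S → (Option ι → List (Letter S)) → Prop}
    (h : ∀ b, WordTest (Q b)) (i : ι) :
    WordTest fun w => ∃ b t, b :: t <:+ w i ∧ Q b (extendEnv w t) := by
  obtain ⟨N, T, h⟩ := WordTest.uniform h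
  refine ⟨N + 2, (.X * 5 + 2) + (1 + (.X * (1 + (T + 4)) + 1)),
    fun ρ a fr hL => ?_⟩
  have hL' := hL.mono (N' := N + 1) (by omega)
  choose q hq using fun b => h b _ a _ hL'.extend
  refine ⟨(copy (ρ i) (fr 0) (fr 1)).seq ((push a (.bit false)).seq
    (forAll (fr 0) fun b => (q b).seq (accumulate a))), fun s n hn hs => ?_⟩
  have ha := hL.aux_ne_ans 0 (by omega)
  have h01 : fr 0 ≠ fr 1 := fun e => absurd (hL.aux_inj 0 (by omega) 1 (by omega) e) (by omega)
  -- Loop invariant: the top of the answer stack holds `c`, the disjunction of the results so far.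
  -- It has to be arbitrary for the induction on the unread word `l`.
  have hloop : ∀ (l : List (Letter S)) (c : Prop), l.length ≤ n →
      RunsIn (forAll (fr 0) fun b => (q b).seq (accumulate a))
        (update (update s (fr 0) l) a (ansLetter S c :: s a))
        (update s a (ansLetter S (c ∨ ∃ b t, b :: t <:+ l ∧ Q b (extendEnv (s ∘ ρ) t)) :: s a))
        (l.length * (1 + (T.eval n + 4)) + 1) := by
    intro l
    induction l with
    | nil =>
      intro c _
      refine ((runsIn_loop_nil ?_).congr ?_).mono (by omega)
      · simp [ha]
      · rw [update_eq_of_eq (hs 0 (by omega))]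
        simp
    | cons b l ih =>
      intro c hln
      have hln' : l.length ≤ n := (Nat.le_succ _).trans hln
      have hq := hq b (update (update s (fr 0) l) a (ansLetter S c :: s a)) n (by
          intro o
          have h1 := length_extend_le hL' hn (t := l) hln' o
          rwa [update_of_ne (hL'.extend.var_ne_ans o)])
        (fun j hj => by
          rw [update_of_ne (hL.aux_ne_ans _ (by omega))]
          exact aux_update_eq_nil hL' _ (fun j hj => hs j (by omega)) hj)
      have hcomp : update (update s (fr 0) l) a (ansLetter S c :: s a) ∘ extendEnv ρ (fr 0) =
          extendEnv (s ∘ ρ) l := by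
        rw [← comp_extend_update hL' s l]
        funext o
        simp [hL'.extend.var_ne_ans o]
      rw [hcomp] at hq
      have hbody := hq.seq ((runsIn_accumulate (a := a) (P := Q b (extendEnv (s ∘ ρ) l))
        (Q := c) (l := s a) (by simp)).congr
        (s'' := update (update s (fr 0) l) a
          (ansLetter S (c ∨ Q b (extendEnv (s ∘ ρ) l)) :: s a)) (by simp))
      have ih := ih (c ∨ Q b (extendEnv (s ∘ ρ) l)) hln'
      have hiff : (c ∨ Q b (extendEnv (s ∘ ρ) l)) ∨
          (∃ b t, b :: t <:+ l ∧ Q b (extendEnv (s ∘ ρ) t)) ↔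
          c ∨ ∃ b' t, b' :: t <:+ b :: l ∧ Q b' (extendEnv (s ∘ ρ) t) := by
        constructor
        · rintro ((h | h) | ⟨b', t, h, h'⟩)
          · exact .inl h
          · exact .inr ⟨b, l, List.suffix_refl _, h⟩
          · exact .inr ⟨b', t, h.trans (List.suffix_cons _ _), h'⟩
        · rintro (h | ⟨b', t, h, h'⟩)
          · exact .inl (.inl h)
          · rcases List.suffix_cons_iff.1 h with h | h
            · simp only [List.cons.injEq] at h
              obtain ⟨rfl, rfl⟩ := h
              exact .inl (.inr h')
            · exact .inr ⟨b', t, h, h'⟩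
      rw [ansLetter_congr hiff] at ih
      refine (RunsIn.loop_go (a := b) (l := l) (by simp [ha]) rfl (T := T.eval n + 4)
        ?_ ih).mono ?_
      · rw [update_comm ha.symm, update_idem]
        exact hbody
      · simp only [List.length_cons, Nat.add_mul]; omega
  have hni := hn i
  have hloop := hloop (s (ρ i)) False hni
  simp only [Polynomial.eval_add, Polynomial.eval_one, Polynomial.eval_mul, Polynomial.eval_X,
    Polynomial.eval_ofNat]
  refine ((runsIn_copy (hL.var_ne_aux i 0 (by omega)) (hL.var_ne_aux i 1 (by omega)) h01 s
    (hs 0 (by omega)) (hs 1 (by omega))).mono (by omega)).seq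
    ((runsIn_push _ _ _).seq ?_)
  rw [update_of_ne ha.symm, ← ansLetter_false]
  refine (hloop.congr ?_).mono ?_
  · simp only [false_or]; rfl
  · gcongr

/-! ### Comparison of values -/

/-- The result of the comparison of two words, as far as the first letters determine it. -/
def cmpLetter : Letter S → Option (Letter S) → Option Bool
  | .bit u, some (.bit v) => if u = v then none else some (!u && v)
  | .sep, some (.bit _) => some true
  | _, _ => some false

/-- Lexicographic comparison of the values at the beginning of two words. -/
def valueLt : List (Letter S) → List (Letter S) → Bool
  | [], _ => false
  | b :: l, m => (cmpLetter b m.head?).getD (valueLt l m.tail)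

/-- The program that compares the words on `x` and `z` letter by letter; the result is
put on the stack `y`. -/
def cmpBody (y z : K) (b : Letter S) : StackProg K (Letter S) :=
  .pop y fun o => o.elim
    (.pop z fun o' => (cmpLetter b o').elim skip fun r => push y (.bit r)) fun r => push y r

theorem update_three {K α : Type} [DecidableEq K] {x y z : K} (hxy : x ≠ y) (hxz : x ≠ z)
    (hyz : y ≠ z) {s s' : K → α} {u v w : α} (h : ∀ k, k ≠ x → k ≠ y → k ≠ z → s k = s' k) :
    update (update (update s x u) z v) y w = update (update (update s' x u) z v) y w := by
  funext k
  by_cases h1 : k = x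
  · subst h1; simp [hxy, hxz]
  · by_cases h2 : k = y
    · subst h2; simp
    · by_cases h3 : k = z
      · subst h3; simp [hyz.symm]
      · simp [h1, h2, h3, h k h1 h2 h3]

theorem runsIn_cmp {K : Type} [DecidableEq K] {x y z : K} (hxy : x ≠ y) (hxz : x ≠ z)
    (hyz : y ≠ z) (s : K → List (Letter S)) (hy : (s y).length ≤ 1) :
    ∃ m f, RunsIn (forAll x (cmpBody y z)) s
        (update (update (update s x []) z m) y f) ((s x).length * 4 + 1) ∧
      m.length ≤ (s z).length ∧ f.length ≤ 1 ∧
      (f.head? = some (.bit true) ↔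
        if s y = [] then valueLt (s x) (s z) = true else (s y).head? = some (.bit true)) := by
  generalize hl : s x = l
  induction l generalizing s with
  | nil =>
    refine ⟨s z, s y, (runsIn_loop_nil hl).congr ?_, le_rfl, hy, ?_⟩
    · rw [update_eq_of_eq hl, update_eq_self, update_eq_self]
    · by_cases h : s y = [] <;> simp [h, valueLt]
  | cons b l ih =>
    by_cases h : s y = []
    · cases hc : cmpLetter b (s z).head? with
      | none =>
        obtain ⟨m, f, hrun, hm, hf, hiff⟩ := ih (update (update s x l) z (s z).tail)
          (by simp [hxy.symm, hyz, h]) (by simp [hxz])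
        refine ⟨m, f, (RunsIn.loop_go hl rfl (T := 1 + (1 + 1)) (.pop ?_) (hrun.congr ?_)).mono ?_,
          ?_, hf, ?_⟩
        · simp only [update_of_ne hxy.symm, h, List.head?_nil, Option.elim_none, List.tail_nil]
          refine .pop ?_
          have e : update (update s x l) y [] = update s x l :=
            update_eq_of_eq (by simp [hxy.symm, h])
          rw [e]
          simp only [update_of_ne hxz.symm, hc, Option.elim_none]
          exact runsIn_skip _
        · exact update_three hxy hxz hyz (by simp +contextual)
        · simp; omega
        · simp at hm; omega
        · rw [hiff]
          simp [hxy.symm, hyz, h, valueLt, hc]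
      | some r =>
        obtain ⟨m, f, hrun, hm, hf, hiff⟩ := ih
          (update (update (update s x l) z (s z).tail) y [.bit r])
          (by simp) (by simp [hxz, hxy])
        refine ⟨m, f, (RunsIn.loop_go hl rfl (T := 1 + (1 + 1)) (.pop ?_) (hrun.congr ?_)).mono ?_,
          ?_, hf, ?_⟩
        · simp only [update_of_ne hxy.symm, h, List.head?_nil, Option.elim_none, List.tail_nil]
          refine .pop ?_
          have e : update (update s x l) y [] = update s x l :=
            update_eq_of_eq (by simp [hxy.symm, h])
          rw [e]
          simp only [update_of_ne hxz.symm, hc, Option.elim_some]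
          refine (runsIn_push _ _ _).congr ?_
          simp [hyz, hxy.symm, h]
        · exact update_three hxy hxz hyz (by simp +contextual)
        · simp; omega
        · simp [hyz.symm] at hm; omega
        · rw [hiff]
          simp [h, valueLt, hc]
    · obtain ⟨r, hr⟩ : ∃ r, s y = [r] := by
        rcases hsy : s y with _ | ⟨r, _ | ⟨r', t⟩⟩
        · exact absurd hsy h
        · exact ⟨r, rfl⟩
        · simp [hsy] at hy
      obtain ⟨m, f, hrun, hm, hf, hiff⟩ := ih (update s x l)
        (by simp [hxy.symm, hr]) (by simp)
      refine ⟨m, f, (RunsIn.loop_go hl rfl (T := 1 + 1) (.pop ?_) (hrun.congr ?_)).mono ?_,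
        ?_, hf, ?_⟩
      · simp only [update_of_ne hxy.symm, hr, List.head?_cons, Option.elim_some, List.tail_cons]
        refine (runsIn_push _ _ _).congr ?_
        rw [update_self, update_idem]
        exact update_eq_of_eq (by simp [hxy.symm, hr])
      · rw [update_idem]
      · simp; omega
      · simpa [hxz.symm] using hm
      · rw [hiff]
        simp [hxy.symm, hr]

theorem wordTest_valueLt {ι : Type} (i j : ι) :
    WordTest fun w : ι → List (Letter S) => valueLt (w i) (w j) = true := by
  refine ⟨3, (.X * 5 + 2) + ((.X * 5 + 2) + ((.X * 4 + 1) + ((.X * 2 + 1) + (1 + 1)))),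
    fun ρ a fr hL => ?_⟩
  refine ⟨(copy (ρ i) (fr 0) (fr 1)).seq ((copy (ρ j) (fr 2) (fr 1)).seq
    ((forAll (fr 0) (cmpBody (fr 1) (fr 2))).seq ((clear (fr 2)).seq (.pop (fr 1) fun o =>
      push a (ansLetter S (o = some (.bit true))))))), fun s n hn hs => ?_⟩
  have hne : ∀ u < 3, ∀ v < 3, u ≠ v → fr u ≠ fr v := fun u hu v hv h e =>
    h (hL.aux_inj u hu v hv e)
  have h01 := hne 0 (by omega) 1 (by omega) (by omega)
  have h02 := hne 0 (by omega) 2 (by omega) (by omega)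
  have h12 := hne 1 (by omega) 2 (by omega) (by omega)
  have ha0 := hL.aux_ne_ans 0 (by omega)
  have ha1 := hL.aux_ne_ans 1 (by omega)
  have ha2 := hL.aux_ne_ans 2 (by omega)
  have hs0 := hs 0 (by omega)
  have hs1 := hs 1 (by omega)
  have hs2 := hs 2 (by omega)
  have hj0 := hL.var_ne_aux j 0 (by omega)
  have hni := hn i
  have hnj := hn j
  obtain ⟨m, f, hrun, hm, hf, hiff⟩ := runsIn_cmp h01 h02 h12
    (update (update s (fr 0) (s (ρ i))) (fr 2) (s (ρ j))) (by simp [h12, h01.symm, hs1])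
  simp only [update_self, update_of_ne h02, update_of_ne h12, update_of_ne h01.symm, hs1,
    if_true] at hrun hm hiff
  simp only [Polynomial.eval_add, Polynomial.eval_one, Polynomial.eval_mul, Polynomial.eval_X,
    Polynomial.eval_ofNat]
  refine ((runsIn_copy (hL.var_ne_aux i 0 (by omega)) (hL.var_ne_aux i 1 (by omega)) h01 s
    hs0 hs1).mono (by omega)).seq (((runsIn_copy (hL.var_ne_aux j 2 (by omega))
      (hL.var_ne_aux j 1 (by omega)) h12.symm _ (by simp [h02.symm, hs2])
      (by simp [h01.symm, hs1])).congr ?_ |>.mono ?_).seq ((hrun.mono (by omega)).seq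
      (((runsIn_clear _ _).mono ?_).seq (.pop ((runsIn_push _ _ _).congr ?_)))))
  · rw [update_of_ne hj0]
  · rw [update_of_ne hj0]; omega
  · simp [h12.symm]; omega
  · have h1 : f.tail = [] := by
      rcases f with _ | ⟨r, _ | ⟨r', t⟩⟩
      · rfl
      · rfl
      · simp at hf
    simp only [update_of_ne h12, update_self, h1, ansLetter_congr hiff]
    rw [update_of_ne ha1.symm, update_of_ne ha2.symm, update_of_ne ha1.symm, update_of_ne ha2.symm,
      update_of_ne ha0.symm, update_of_ne ha2.symm, update_of_ne ha0.symm]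
    congr 1
    funext k
    by_cases hk1 : k = fr 1
    · subst hk1; simp [hs1]
    · by_cases hk2 : k = fr 2
      · subst hk2; simp [hk1, hs2]
      · by_cases hk0 : k = fr 0
        · subst hk0; simp [hk1, hk2, hs0]
        · simp [hk0, hk1, hk2]

end WordTests

/-! ### From tests on words to polynomial time -/

section Decision

open StackProg Function

variable {S : Schema}

theorem WordTest.inPTime {α : Type} {Q : (Unit → List (Letter S)) → Prop} (h : WordTest Q)
    (enc : α → List (Letter S)) (P : α → Prop) (hP : ∀ x, Q (fun _ => enc x) ↔ P x) :
    InPTime enc P := by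
  obtain ⟨N, T, h⟩ := h
  -- Stack 0 holds the input, stack 1 the answer, and the auxiliary stacks start at 2; the value for
  -- `j ≥ N` plays no role.
  set fr : ℕ → Fin (N + 2) := fun j => if hj : j < N then ⟨j + 2, by omega⟩ else 0 with hfr
  have hfr' : ∀ j < N, ((fr j : Fin (N + 2)) : ℕ) = j + 2 := fun j hj => by simp [hfr, hj]
  have hL : Layout N (fun _ : Unit => (0 : Fin (N + 2))) 1 fr :=
    { var_ne_ans := fun _ => by simp
      aux_ne_ans := fun j hj e => by
        have := hfr' j hj
        rw [e] at this
        simp at this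
      var_ne_aux := fun _ j hj e => by
        have := hfr' j hj
        rw [← e] at this
        simp at this
      aux_inj := fun i hi j hj e => by
        have h1 := hfr' i hi
        have h2 := hfr' j hj
        rw [e] at h1
        omega }
  obtain ⟨p, hp⟩ := h _ _ _ hL
  refine inPTime_of_runs (inp := 0) (ans := 1) (yes := .bit true) (p.seq (clear 0)) enc P
    (T + (.X * 2 + 1)) fun x => ?_
  have h01 : (0 : Fin (N + 2)) ≠ 1 := by simp
  obtain ⟨t, ht, hrun⟩ := (hp (update (fun _ => []) 0 (enc x)) (enc x).length (by simp)
    (fun j hj => by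
      rw [update_of_ne]
      exact (hL.var_ne_aux () j hj).symm)).seq ((runsIn_clear 0 _).congr
        (s'' := update (fun _ => []) 1 [ansLetter S (P x)]) (by
          have : (update (fun _ => []) 0 (enc x) ∘ fun _ : Unit => (0 : Fin (N + 2))) =
            fun _ => enc x := by
              funext i
              simp
          rw [this, ansLetter_congr (hP x), update_comm h01.symm, update_idem]
          have e : update (fun _ : Fin (N + 2) => ([] : List (Letter S))) 0 [] = fun _ => [] :=
            update_eq_of_eq rfl
          rw [e]
          simp [h01.symm]))
  refine ⟨t, ht.trans ?_, ansLetter S (P x), ansLetter_eq_true, hrun⟩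
  simp [h01]

end Decision

/-! ### Values and tuples as words -/

section Encodings

variable {S : Schema}

/-- The remainder of a word after its first value. -/
noncomputable def dropValue (l : List (Letter S)) : List (Letter S) :=
  (l.dropWhile fun a => decide (a ≠ Letter.sep)).tail

theorem WordTest.dropValue {ι : Type} {Q : (Option ι → List (Letter S)) → Prop} (h : WordTest Q)
    (i : ι) : WordTest fun w => Q (extendEnv w (dropValue (w i))) :=
  WordTest.dropWhile (Q := fun _ => Q) (fun _ => h) _ i

/-- A pointer to the beginning of a tuple yields pointers to all its values by skipping one value
after the other. The induction keeps the current pointer as a variable and adds the next one. -/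
theorem WordTest.values {r : ℕ} : ∀ {κ : Type} {Q : (κ ⊕ Fin r → List (Letter S)) → Prop},
    WordTest Q → WordTest fun w : Option κ → List (Letter S) =>
      Q (Sum.elim (w ∘ some) fun k => _root_.dropValue^[k] (w none)) := by
  induction r with
  | zero =>
    intro κ Q h
    refine (h.rename (κ := Option κ) (Sum.elim some fun k => k.elim0)).congr fun w => ?_
    refine iff_of_eq (congrArg Q ?_)
    funext x
    rcases x with x | k
    · rfl
    · exact k.elim0
  | succ r ih =>
    intro κ Q h
    have h' := h.rename (κ := Option κ ⊕ Fin r) (Sum.elim (Sum.inl ∘ some)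
      (Fin.cases (Sum.inl none) fun k => Sum.inr k))
    refine ((ih h').dropValue none).congr fun w => ?_
    refine iff_of_eq (congrArg Q ?_)
    funext x
    rcases x with x | k
    · rfl
    · refine Fin.cases ?_ (fun k => ?_) k
      · rfl
      · rfl

variable {V : Type} [LinearOrder V] (enc : V ↪o List Bool)

theorem dropValue_append (v : V) (l : List (Letter S)) :
    dropValue (encodeValue enc v ++ l) = l := by
  unfold dropValue encodeValue
  induction enc v with
  | nil => simp
  | cons b u ih => simpa using ih

theorem encodeTuple_succ {k : ℕ} (t : Fin (k + 1) → V) :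
    encodeTuple (S := S) enc t = encodeValue enc (t 0) ++ encodeTuple enc fun i => t i.succ := by
  simp [encodeTuple, List.ofFn_succ]

theorem encodeTuple_snoc {k : ℕ} (t : Fin k → V) (v : V) :
    encodeTuple (S := S) enc (Fin.snoc (α := fun _ => V) t v) =
      encodeTuple enc t ++ encodeValue enc v := by
  rw [encodeTuple, List.ofFn_succ', List.concat_eq_append, List.flatMap_append]
  simp [encodeTuple]

theorem encodeValue_prefix_dropValue {r : ℕ} : ∀ (y : Fin r → V) (t : List (Letter S)),
    encodeTuple enc y <+: t → ∀ k : Fin r, encodeValue enc (y k) <+: dropValue^[k] t := by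
  induction r with
  | zero => exact fun _ _ _ k => k.elim0
  | succ r ih =>
    rintro y _ ⟨l, rfl⟩ k
    rw [encodeTuple_succ, List.append_assoc]
    refine Fin.cases ?_ (fun k => ?_) k
    · exact ⟨_, rfl⟩
    · have := ih (fun i => y i.succ) _ (List.prefix_append _ l) k
      simpa [Function.iterate_succ, dropValue_append] using this

/-- A separator on either side decides the comparison: a proper prefix is smaller, and equal words
are not. Hence nothing behind the separators is ever taken into account. -/
theorem valueLt_append (u v : List Bool) (l m : List (Letter S)) :
    valueLt (u.map Letter.bit ++ Letter.sep :: l) (v.map Letter.bit ++ Letter.sep :: m) = true ↔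
      u < v := by
  induction u generalizing v with
  | nil => cases v <;> simp [valueLt, cmpLetter]
  | cons a u ih =>
    cases v with
    | nil => simp [valueLt, cmpLetter]
    | cons b v =>
      rw [List.cons_lt_cons_iff, ← ih]
      cases a <;> cases b <;> simp [valueLt, cmpLetter]

theorem valueLt_iff {u v : V} {l m : List (Letter S)} (hl : encodeValue enc u <+: l)
    (hm : encodeValue enc v <+: m) : valueLt l m = true ↔ u < v := by
  obtain ⟨l, rfl⟩ := hl
  obtain ⟨m, rfl⟩ := hm
  simp only [encodeValue, List.append_assoc, List.singleton_append]
  rw [valueLt_append]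
  exact enc.lt_iff_lt

/-- The letters that open an atom or an action. -/
def Letter.Opens : Letter S → Prop
  | rel _ => True
  | attr _ _ => True
  | bit _ => False
  | sep => False

theorem not_opens_of_mem_encodeValue {v : V} {a : Letter S} (h : a ∈ encodeValue enc v) :
    ¬ a.Opens := by
  simp only [encodeValue, List.mem_append, List.mem_map, List.mem_singleton] at h
  rcases h with ⟨b, _, rfl⟩ | rfl <;> simp [Letter.Opens]

theorem not_opens_of_mem_encodeTuple {k : ℕ} {t : Fin k → V} {a : Letter S}
    (h : a ∈ encodeTuple enc t) : ¬ a.Opens := by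
  simp only [encodeTuple, List.mem_flatMap] at h
  obtain ⟨v, _, h⟩ := h
  exact not_opens_of_mem_encodeValue enc h

theorem cons_suffix_append {α : Type} {a : α} {t l₁ l₂ : List α} (h : a :: t <:+ l₁ ++ l₂) :
    (∃ u, a :: u <:+ l₁ ∧ t = u ++ l₂) ∨ a :: t <:+ l₂ := by
  obtain ⟨s, hs⟩ := h
  rcases List.append_eq_append_iff.1 hs with ⟨u, h1, h2⟩ | ⟨u, h1, h2⟩
  · rcases u with _ | ⟨b, u⟩
    · exact .inr ⟨[], by simpa using h2⟩
    · simp only [List.cons_append, List.cons.injEq] at h2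
      obtain ⟨rfl, rfl⟩ := h2
      exact .inl ⟨u, ⟨s, h1.symm⟩, rfl⟩
  · exact .inr ⟨u, h2.symm⟩

/-- The data of an input. -/
abbrev RawInput (S : Schema) (V : Type) : Type := List (S.Fact V) × List (ChangeAction S V)

/-- The word that presents the data of an input. -/
def RawInput.word (L : RawInput S V) : List (Letter S) :=
  L.1.flatMap (encodeFact enc) ++ L.2.flatMap (encodeAction enc)

/-- Encoded values consist of bits and separators, and actions are opened by attribute letters. So a
relation letter occurs only where a stored atom begins. -/
theorem exists_fact_of_suffix {R : S.Rel} {t : List (Letter S)} {L : RawInput S V}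
    (h : Letter.rel R :: t <:+ L.word enc) :
    ∃ y, (⟨R, y⟩ : S.Fact V) ∈ L.1 ∧ encodeTuple enc y <+: t := by
  obtain ⟨fs, us⟩ := L
  unfold RawInput.word at h
  dsimp only at h ⊢
  induction fs with
  | nil =>
    exfalso
    have hm : Letter.rel R ∈ us.flatMap (encodeAction enc) := by
      simpa using h.subset List.mem_cons_self
    obtain ⟨u, _, hu⟩ := List.mem_flatMap.1 hm
    simp only [encodeAction, List.mem_cons, List.mem_append, reduceCtorEq, false_or] at hu
    rcases hu with hu | hu
    · exact not_opens_of_mem_encodeTuple enc hu trivial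
    · exact not_opens_of_mem_encodeValue enc hu trivial
  | cons f fs ih =>
    rw [List.flatMap_cons, List.append_assoc] at h
    rcases cons_suffix_append h with ⟨u, hu, rfl⟩ | h
    · rcases List.suffix_cons_iff.1 hu with hu | hu
      · simp only [List.cons.injEq, Letter.rel.injEq] at hu
        obtain ⟨rfl, rfl⟩ := hu
        exact ⟨f.2, by simp, List.prefix_append _ _⟩
      · exact absurd trivial (not_opens_of_mem_encodeTuple enc (hu.subset List.mem_cons_self))
    · obtain ⟨y, hy, hy'⟩ := ih h
      exact ⟨y, by simp [hy], hy'⟩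

theorem exists_suffix_of_fact {f : S.Fact V} {L : RawInput S V} (h : f ∈ L.1) :
    ∃ t, Letter.rel f.1 :: t <:+ L.word enc ∧ encodeTuple enc f.2 <+: t := by
  obtain ⟨l₁, l₂, hl⟩ := List.append_of_mem h
  refine ⟨encodeTuple enc f.2 ++ (l₂.flatMap (encodeFact enc) ++ L.2.flatMap (encodeAction enc)),
    ⟨l₁.flatMap (encodeFact enc), ?_⟩, List.prefix_append _ _⟩
  simp [RawInput.word, hl, encodeFact]

end Encodings

/-! ### Definable predicates -/

section Definable

variable {S : Schema} {V : Type} [LinearOrder V] (enc : V ↪o List Bool)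

/-- The predicate `P` of an input and of values for the variables `ι` can be decided by a program in
polynomial time. -/
def Definable {ι : Type} (P : RawInput S V → (ι → V) → Prop) : Prop :=
  ∃ Q : (Option ι → List (Letter S)) → Prop, WordTest Q ∧ ∀ L ν w, w none = L.word enc →
    (∀ i, encodeValue enc (ν i) <+: w (some i)) → (Q w ↔ P L ν)

variable {enc}

theorem Definable.congr {ι : Type} {P P' : RawInput S V → (ι → V) → Prop} (h : Definable enc P)
    (hP : ∀ L ν, P L ν ↔ P' L ν) : Definable enc P' := by
  have : P = P' := funext fun L => funext fun ν => propext (hP L ν)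
  exact this ▸ h

theorem definable_const {ι : Type} (c : Prop) :
    Definable enc fun (_ : RawInput S V) (_ : ι → V) => c :=
  ⟨_, wordTest_const c, fun _ _ _ _ _ => Iff.rfl⟩

theorem Definable.not {ι : Type} {P : RawInput S V → (ι → V) → Prop} (h : Definable enc P) :
    Definable enc fun L ν => ¬ P L ν := by
  obtain ⟨Q, hQ, h⟩ := h
  exact ⟨_, hQ.not, fun L ν w hw hν => not_congr (h L ν w hw hν)⟩

theorem Definable.and {ι : Type} {P P' : RawInput S V → (ι → V) → Prop} (h : Definable enc P)
    (h' : Definable enc P') : Definable enc fun L ν => P L ν ∧ P' L ν := by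
  obtain ⟨Q, hQ, h⟩ := h
  obtain ⟨Q', hQ', h'⟩ := h'
  exact ⟨_, hQ.and hQ', fun L ν w hw hν => and_congr (h L ν w hw hν) (h' L ν w hw hν)⟩

theorem Definable.or {ι : Type} {P P' : RawInput S V → (ι → V) → Prop} (h : Definable enc P)
    (h' : Definable enc P') : Definable enc fun L ν => P L ν ∨ P' L ν :=
  (h.not.and h'.not).not.congr fun _ _ => by tauto

theorem Definable.imp {ι : Type} {P P' : RawInput S V → (ι → V) → Prop} (h : Definable enc P)
    (h' : Definable enc P') : Definable enc fun L ν => P L ν → P' L ν :=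
  (h.and h'.not).not.congr fun _ _ => by tauto

theorem Definable.rename {ι κ : Type} {P : RawInput S V → (ι → V) → Prop} (h : Definable enc P)
    (f : ι → κ) : Definable enc fun L ν => P L (ν ∘ f) := by
  obtain ⟨Q, hQ, h⟩ := h
  exact ⟨_, hQ.rename (Option.map f), fun L ν w hw hν =>
    h L (ν ∘ f) (w ∘ Option.map f) hw fun i => hν (f i)⟩

theorem Definable.forall_finset {α ι : Type} {P : α → RawInput S V → (ι → V) → Prop}
    (h : ∀ x, Definable enc (P x)) (s : Finset α) :
    Definable enc fun L ν => ∀ x ∈ s, P x L ν := by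
  classical
  induction s using Finset.induction_on with
  | empty => exact (definable_const True).congr fun _ _ => by simp
  | insert x s _ ih => exact ((h x).and ih).congr fun _ _ => by simp

theorem Definable.exists_finset {α ι : Type} {P : α → RawInput S V → (ι → V) → Prop}
    (h : ∀ x, Definable enc (P x)) (s : Finset α) :
    Definable enc fun L ν => ∃ x ∈ s, P x L ν :=
  (Definable.forall_finset (fun x => (h x).not) s).not.congr fun _ _ => by push Not; rfl

theorem Definable.forall_finite {α ι : Type} [Finite α] {P : α → RawInput S V → (ι → V) → Prop}
    (h : ∀ x, Definable enc (P x)) : Definable enc fun L ν => ∀ x, P x L ν := by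
  cases nonempty_fintype α
  exact (Definable.forall_finset h Finset.univ).congr fun _ _ => by simp

theorem Definable.exists_finite {α ι : Type} [Finite α] {P : α → RawInput S V → (ι → V) → Prop}
    (h : ∀ x, Definable enc (P x)) : Definable enc fun L ν => ∃ x, P x L ν := by
  cases nonempty_fintype α
  exact (Definable.exists_finset h Finset.univ).congr fun _ _ => by simp

theorem Definable.const {ι : Type} {P : RawInput S V → (Option ι → V) → Prop}
    (h : Definable enc P) (c : V) : Definable enc fun L ν => P L (extendEnv ν c) := by
  obtain ⟨Q, hQ, h⟩ := h
  refine ⟨_, (hQ.rename (κ := Option (Option ι)) fun o =>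
    o.elim (some none) fun o' => o'.elim none fun i => some (some i)).const (encodeValue enc c),
    fun L ν w hw hν => h L _ _ hw fun o => ?_⟩
  cases o with
  | none => exact List.prefix_refl _
  | some i => exact hν i

theorem definable_lt {ι : Type} (i j : ι) :
    Definable enc fun (_ : RawInput S V) (ν : ι → V) => ν i < ν j :=
  ⟨_, wordTest_valueLt (some i) (some j), fun _ _ _ _ hν => valueLt_iff enc (hν i) (hν j)⟩

theorem definable_eq {ι : Type} (i j : ι) :
    Definable enc fun (_ : RawInput S V) (ν : ι → V) => ν i = ν j :=
  ((definable_lt i j).not.and (definable_lt j i).not).congr fun _ ν => by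
    rw [not_lt, not_lt, and_comm, ← le_antisymm_iff]

theorem definable_eq_const {ι : Type} (i : ι) (c : V) :
    Definable enc fun (_ : RawInput S V) (ν : ι → V) => ν i = c :=
  (definable_eq (some i) none).const c

/-- Quantification over the atoms of the input. -/
theorem Definable.exists_fact {ι : Type}
    {P : ∀ R : S.Rel, RawInput S V → (ι ⊕ Fin (S.arity R) → V) → Prop}
    (h : ∀ R, Definable enc (P R)) :
    Definable enc fun L ν => ∃ f ∈ L.1, P f.1 L (Sum.elim ν f.2) := by
  choose Q hQ h using h
  have hmap : ∀ R : S.Rel, WordTest fun w : Option (Option ι) → List (Letter S) =>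
      Q R ((Sum.elim (w ∘ some) fun k : Fin (S.arity R) => dropValue^[k] (w none)) ∘ fun o =>
        o.elim (Sum.inl none) (Sum.elim (Sum.inl ∘ some) Sum.inr)) := fun R =>
    ((hQ R).rename (κ := Option ι ⊕ Fin (S.arity R)) fun o =>
      o.elim (Sum.inl none) (Sum.elim (Sum.inl ∘ some) Sum.inr)).values
  have hspec : ∀ (R : S.Rel) (L : RawInput S V) (ν : ι → V) (w : Option ι → List (Letter S))
      (y : S.Tuple V R) (t : List (Letter S)), w none = L.word enc →
      (∀ i, encodeValue enc (ν i) <+: w (some i)) → encodeTuple enc y <+: t →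
      (Q R ((Sum.elim (extendEnv w t ∘ some) fun k : Fin (S.arity R) =>
        dropValue^[k] (extendEnv w t none)) ∘ fun o =>
          o.elim (Sum.inl none) (Sum.elim (Sum.inl ∘ some) Sum.inr)) ↔ P R L (Sum.elim ν y)) := by
    intro R L ν w y t hw hν hy
    refine h R L _ _ hw fun i => ?_
    rcases i with i | k
    · exact hν i
    · exact encodeValue_prefix_dropValue enc y t hy k
  refine ⟨_, WordTest.exists_suffix (i := none) (Q := fun b w => ∃ R, b = Letter.rel R ∧
    Q R ((Sum.elim (w ∘ some) fun k : Fin (S.arity R) => dropValue^[k] (w none)) ∘ fun o =>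
        o.elim (Sum.inl none) (Sum.elim (Sum.inl ∘ some) Sum.inr))) (fun b => ?_), ?_⟩
  · cases b with
    | rel R =>
      refine (hmap R).congr fun w => ?_
      constructor
      · exact fun h => ⟨R, rfl, h⟩
      · rintro ⟨R', h1, h2⟩
        cases h1
        exact h2
    | attr R A => exact (wordTest_const False).congr fun w => by simp
    | bit b => exact (wordTest_const False).congr fun w => by simp
    | sep => exact (wordTest_const False).congr fun w => by simp
  · intro L ν w hw hν
    constructor
    · rintro ⟨_, t, ht, R, rfl, hQR⟩
      rw [hw] at ht
      obtain ⟨y, hy, hyt⟩ := exists_fact_of_suffix enc ht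
      exact ⟨⟨R, y⟩, hy, (hspec R L ν w y t hw hν hyt).1 hQR⟩
    · rintro ⟨f, hf, hP⟩
      obtain ⟨t, ht, hft⟩ := exists_suffix_of_fact enc hf
      exact ⟨_, t, hw ▸ ht, f.1, rfl, (hspec f.1 L ν w f.2 t hw hν hft).2 hP⟩

variable (enc) in
/-- Definability of a predicate that also depends on a list of `j` actions. -/
def DefinableUpd : ℕ → ∀ {ι : Type},
    (RawInput S V → (ι → V) → List (ChangeAction S V) → Prop) → Prop
  | 0, _, P => Definable enc fun L ν => P L ν []
  | j + 1, ι, P => ∀ (R : S.Rel) (A : Fin (S.arity R)),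
      DefinableUpd j (ι := ι ⊕ Fin (S.arity R + 1)) fun L ν us =>
        P L (ν ∘ Sum.inl) (⟨R, fun i => ν (Sum.inr i.castSucc), A, ν (Sum.inr (Fin.last _))⟩ :: us)

/-- Letters that do not open an action. -/
def Letter.notAttr : Letter S → Bool
  | attr _ _ => false
  | _ => true

theorem Letter.notAttr_of_not_opens {a : Letter S} (h : ¬ a.Opens) : a.notAttr = true := by
  cases a <;> simp_all [Letter.Opens, Letter.notAttr]

/-- The new value is read as one more component of the tuple, so that an action is parsed in the
same way as an atom. -/
theorem encodeAction_eq (u : ChangeAction S V) : encodeAction enc u = Letter.attr u.rel u.attr ::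
    encodeTuple enc (Fin.snoc (α := fun _ => V) u.tuple u.value) := by
  rw [encodeTuple_snoc]
  rfl

/-- The variable `none` points into the list of actions. The test skips to the next opening letter,
branches on the finitely many pairs of a relation and an attribute, and introduces the values behind
this letter as new variables. The prefix `l` is what is left unread before the next action: at the
start all the atoms, later the values of the preceding action. -/
theorem DefinableUpd.exists_wordTest : ∀ {j : ℕ} {ι : Type}
    {P : RawInput S V → (ι → V) → List (ChangeAction S V) → Prop}, DefinableUpd enc j P →
    ∃ Q : (Option (Option ι) → List (Letter S)) → Prop, WordTest Q ∧
      ∀ L ν us w l, us.length = j → (∀ a ∈ l, Letter.notAttr a = true) →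
        w none = l ++ us.flatMap (encodeAction enc) → w (some none) = L.word enc →
        (∀ i, encodeValue enc (ν i) <+: w (some (some i))) → (Q w ↔ P L ν us) := by
  intro j
  induction j with
  | zero =>
    intro ι P h
    obtain ⟨Q, hQ, h⟩ := h
    refine ⟨_, hQ.rename some, fun L ν us w l hus _ _ hw hν => ?_⟩
    obtain rfl := List.length_eq_zero_iff.1 hus
    exact h L ν _ hw hν
  | succ j ih =>
    intro ι P h
    choose Q hQ h using fun R A => ih (h R A)
    have hmap : ∀ (R : S.Rel) (A : Fin (S.arity R)),
        WordTest fun w : Option (Option (Option ι)) → List (Letter S) =>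
        Q R A ((Sum.elim w fun k : Fin (S.arity R + 1) => dropValue^[k] (w none)) ∘ fun o =>
          o.elim (Sum.inl none) fun o' => o'.elim (Sum.inl (some (some none)))
            (Sum.elim (fun i => Sum.inl (some (some (some i)))) Sum.inr)) := fun R A =>
      (((hQ R A).rename (κ := Option (Option (Option ι)) ⊕ Fin (S.arity R + 1)) fun o =>
        o.elim (Sum.inl none) fun o' => o'.elim (Sum.inl (some (some none)))
          (Sum.elim (fun i => Sum.inl (some (some (some i)))) Sum.inr)).values).rename
        fun o => o.elim none id
    refine ⟨_, WordTest.dropWhile (i := none) (p := Letter.notAttr) (Q := fun b w => ∃ R A,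
      b = some (Letter.attr R A) ∧
      Q R A ((Sum.elim w fun k : Fin (S.arity R + 1) => dropValue^[k] (w none)) ∘ fun o =>
          o.elim (Sum.inl none) fun o' => o'.elim (Sum.inl (some (some none)))
            (Sum.elim (fun i => Sum.inl (some (some (some i)))) Sum.inr))) (fun b => ?_), ?_⟩
    · rcases b with _ | ⟨R | ⟨R, A⟩ | b | _⟩
      case some.attr =>
        refine (hmap R A).congr fun w => ?_
        constructor
        · exact fun h => ⟨R, A, rfl, h⟩
        · rintro ⟨R', A', h1, h2⟩
          cases h1
          exact h2
      all_goals exact (wordTest_const False).congr fun w => by simp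
    · intro L ν us w l hus hl hw hword hν
      obtain ⟨u, us, rfl⟩ : ∃ u us', us = u :: us' := by
        cases us with
        | nil => simp at hus
        | cons u us => exact ⟨u, us, rfl⟩
      have hdrop : (w none).dropWhile Letter.notAttr = Letter.attr u.rel u.attr ::
          (encodeTuple enc (Fin.snoc (α := fun _ => V) u.tuple u.value) ++
            us.flatMap (encodeAction enc)) := by
        rw [hw, List.dropWhile_append_of_pos hl, List.flatMap_cons, encodeAction_eq,
          List.cons_append, List.dropWhile_cons_of_neg (by simp [Letter.notAttr])]
      rw [hdrop, List.head?_cons, List.tail_cons]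
      have hspec := h u.rel u.attr L
        (Sum.elim ν (Fin.snoc (α := fun _ => V) u.tuple u.value)) us
        ((Sum.elim (extendEnv w (encodeTuple enc (Fin.snoc (α := fun _ => V) u.tuple u.value) ++
            us.flatMap (encodeAction enc))) fun k : Fin (S.arity u.rel + 1) =>
          dropValue^[k] (encodeTuple enc (Fin.snoc (α := fun _ => V) u.tuple u.value) ++
            us.flatMap (encodeAction enc))) ∘ fun o =>
          o.elim (Sum.inl none) fun o' => o'.elim (Sum.inl (some (some none)))
            (Sum.elim (fun i => Sum.inl (some (some (some i)))) Sum.inr))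
        (encodeTuple enc (Fin.snoc (α := fun _ => V) u.tuple u.value)) (by simpa using hus)
        (fun a ha => Letter.notAttr_of_not_opens (not_opens_of_mem_encodeTuple enc ha)) rfl hword
        (fun i => by
          rcases i with i | k
          · exact hν i
          · exact encodeValue_prefix_dropValue (S := S) enc
              (Fin.snoc (α := fun _ => V) u.tuple u.value) _ (List.prefix_append _ _) k)
      have hu : (⟨u.rel, fun i => (Sum.elim ν (Fin.snoc (α := fun _ => V) u.tuple u.value))
          (Sum.inr i.castSucc), u.attr, (Sum.elim ν (Fin.snoc (α := fun _ => V) u.tuple u.value))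
          (Sum.inr (Fin.last _))⟩ : ChangeAction S V) = u := by
        simp
      rw [hu, Sum.elim_comp_inl] at hspec
      rw [← hspec]
      constructor
      · rintro ⟨R, A, h1, h2⟩
        cases h1
        exact h2
      · exact fun h => ⟨u.rel, u.attr, rfl, h⟩

theorem DefinableUpd.inPTime {IC : List (Denial S V)}
    {dom : ∀ R : S.Rel, Fin (S.arity R) → Finset V} {m : ℕ}
    {P : RawInput S V → (Empty → V) → List (ChangeAction S V) → Prop} (h : DefinableUpd enc m P) :
    InPTime (encodeInput (S := S) (IC := IC) (dom := dom) (m := m) enc) fun x =>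
      P (x.atoms, x.updates) Empty.elim x.updates := by
  obtain ⟨Q, hQ, h⟩ := h.exists_wordTest
  refine (hQ.rename fun _ => ()).inPTime _ _ fun x => ?_
  refine h (x.atoms, x.updates) Empty.elim x.updates _ (x.atoms.flatMap (encodeFact enc))
    x.length_updates (fun a ha => ?_) rfl rfl (fun i => i.elim)
  obtain ⟨f, _, hf⟩ := List.mem_flatMap.1 ha
  simp only [encodeFact, List.mem_cons] at hf
  rcases hf with rfl | hf
  · rfl
  · exact Letter.notAttr_of_not_opens (not_opens_of_mem_encodeTuple enc hf)

end Definable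

/-! ### Ranges of bounded quantifiers -/

section ValueDomain

variable {S : Schema} {V : Type}

/-- The values that occur in the atoms of the input, in the set `C` of constants, or as values of the
variables. -/
def valueDom {ι : Type} (C : Finset V) (L : RawInput S V) (ν : ι → V) : Set V :=
  {v | (∃ f ∈ L.1, ∃ i, f.2 i = v) ∨ v ∈ C ∨ ∃ i, ν i = v}

/-- Nested quantifiers keep the same range, which allows one to quantify over tuples componentwise.
Values of variables belong to the range because an update may introduce a value found neither in the
atoms nor in `C`. -/
theorem valueDom_extendEnv {ι : Type} {C : Finset V} {L : RawInput S V} {ν : ι → V} {v : V}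
    (hv : v ∈ valueDom C L ν) : valueDom C L (extendEnv ν v) = valueDom C L ν := by
  ext x
  constructor
  · rintro (h | h | ⟨_ | i, rfl⟩)
    · exact .inl h
    · exact .inr (.inl h)
    · exact hv
    · exact .inr (.inr ⟨i, rfl⟩)
  · rintro (h | h | ⟨i, rfl⟩)
    · exact .inl h
    · exact .inr (.inl h)
    · exact .inr (.inr ⟨some i, rfl⟩)

theorem valueDom_comp_subset {ι κ : Type} {C : Finset V} {L : RawInput S V} (g : ι → κ)
    (ν : κ → V) : valueDom C L (ν ∘ g) ⊆ valueDom C L ν := by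
  rintro v (h | h | ⟨i, h⟩)
  · exact .inl h
  · exact .inr (.inl h)
  · exact .inr (.inr ⟨g i, h⟩)

end ValueDomain

section DefinableInstances

variable {S : Schema} {V : Type} [LinearOrder V] {enc : V ↪o List Bool}

theorem Definable.exists_value {ι : Type} [Finite ι] {P : RawInput S V → (Option ι → V) → Prop}
    (h : Definable enc P) (C : Finset V) :
    Definable enc fun L ν => ∃ v ∈ valueDom C L ν, P L (extendEnv ν v) := by
  have h1 : Definable enc fun (L : RawInput S V) (ν : ι → V) =>
      ∃ f ∈ L.1, ∃ k, P L (extendEnv ν (f.2 k)) := by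
    refine (Definable.exists_fact (P := fun R L ν => ∃ k : Fin (S.arity R), P L (ν ∘ fun o =>
      o.elim (Sum.inr k) Sum.inl)) fun R => Definable.exists_finite fun k => h.rename _).congr
      fun L ν => ?_
    refine exists_congr fun f => and_congr_right fun _ => exists_congr fun k => ?_
    refine iff_of_eq (congrArg (P L) (funext fun o => ?_))
    cases o <;> rfl
  have h2 := Definable.exists_finset (fun c => h.const c) C
  have h3 : Definable enc fun (L : RawInput S V) (ν : ι → V) => ∃ i, P L (extendEnv ν (ν i)) := by
    refine (Definable.exists_finite fun i : ι => h.rename fun o => o.elim i id).congr fun L ν => ?_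
    refine exists_congr fun i => iff_of_eq (congrArg (P L) (funext fun o => ?_))
    cases o <;> rfl
  refine ((h1.or h2).or h3).congr fun L ν => ?_
  constructor
  · rintro ((⟨f, hf, k, hP⟩ | ⟨c, hc, hP⟩) | ⟨i, hP⟩)
    · exact ⟨_, .inl ⟨f, hf, k, rfl⟩, hP⟩
    · exact ⟨c, .inr (.inl hc), hP⟩
    · exact ⟨_, .inr (.inr ⟨i, rfl⟩), hP⟩
  · rintro ⟨v, ⟨f, hf, k, rfl⟩ | hc | ⟨i, rfl⟩, hP⟩
    · exact .inl (.inl ⟨f, hf, k, hP⟩)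
    · exact .inl (.inr ⟨v, hc, hP⟩)
    · exact .inr ⟨i, hP⟩

theorem Definable.exists_values_fin {n : ℕ} (C : Finset V) : ∀ {ι : Type} [Finite ι]
    {P : RawInput S V → (ι ⊕ Fin n → V) → Prop}, Definable enc P →
    Definable enc fun L ν => ∃ y : Fin n → V, (∀ j, y j ∈ valueDom C L ν) ∧
      P L (Sum.elim ν y) := by
  induction n with
  | zero =>
    intro ι _ P h
    refine (h.rename (Sum.elim id fun k => k.elim0)).congr fun L ν => ?_
    constructor
    · intro h
      refine ⟨Fin.elim0, fun j => j.elim0, ?_⟩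
      convert! h using 1
      funext x
      rcases x with x | k
      · rfl
      · exact k.elim0
    · rintro ⟨y, _, h⟩
      convert! h using 1
      funext x
      rcases x with x | k
      · rfl
      · exact k.elim0
  | succ n ih =>
    intro ι _ P h
    have h' := h.rename (κ := Option ι ⊕ Fin n) (Sum.elim (Sum.inl ∘ some)
      (Fin.cases (Sum.inl none) Sum.inr))
    refine ((ih h').exists_value C).congr fun L ν => ?_
    have key : ∀ (v : V) (y : Fin n → V), Sum.elim (extendEnv ν v) y ∘ (Sum.elim (Sum.inl ∘ some)
        (Fin.cases (Sum.inl none) Sum.inr) : ι ⊕ Fin (n + 1) → Option ι ⊕ Fin n) =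
        Sum.elim ν (Fin.cons (α := fun _ => V) v y) := by
      intro v y
      funext x
      rcases x with x | k
      · rfl
      · refine Fin.cases ?_ (fun k => ?_) k <;> rfl
    constructor
    · rintro ⟨v, hv, y, hy, hP⟩
      rw [key] at hP
      rw [valueDom_extendEnv hv] at hy
      exact ⟨Fin.cons v y, fun j => Fin.cases hv hy j, hP⟩
    · rintro ⟨y, hy, hP⟩
      refine ⟨y 0, hy 0, Fin.tail y, fun j => ?_, ?_⟩
      · rw [valueDom_extendEnv (hy 0)]
        exact hy j.succ
      · rw [key, Fin.cons_self_tail]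
        exact hP

theorem Definable.exists_values {ι J : Type} [Finite ι] [Finite J]
    {P : RawInput S V → (ι ⊕ J → V) → Prop} (h : Definable enc P) (C : Finset V) :
    Definable enc fun L ν => ∃ y : J → V, (∀ j, y j ∈ valueDom C L ν) ∧ P L (Sum.elim ν y) := by
  obtain ⟨n, ⟨e⟩⟩ := Finite.exists_equiv_fin J
  refine ((h.rename (Sum.map id e)).exists_values_fin C).congr fun L ν => ?_
  constructor
  · rintro ⟨y, hy, hP⟩
    refine ⟨y ∘ e, fun j => hy _, ?_⟩
    rwa [Sum.elim_comp_map] at hP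
  · rintro ⟨y, hy, hP⟩
    refine ⟨y ∘ e.symm, fun j => hy _, ?_⟩
    rw [Sum.elim_comp_map]
    convert! hP using 2
    funext j
    simp

/-! ### Definable instances -/

/-- The instance `F` is definable: membership is, and its values are among the known ones. -/
structure DefInst (enc : V ↪o List Bool) (C : Finset V) {ι : Type}
    (F : RawInput S V → (ι → V) → S.Inst V) : Prop where
  mem : ∀ R : S.Rel, Definable enc fun L (ν : ι ⊕ Fin (S.arity R) → V) =>
    (⟨R, ν ∘ Sum.inr⟩ : S.Fact V) ∈ F L (ν ∘ Sum.inl)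
  value_mem : ∀ L ν, ∀ f ∈ F L ν, ∀ i, f.2 i ∈ valueDom C L ν

theorem defInst_atoms (C : Finset V) {ι : Type} :
    DefInst enc C fun (L : RawInput S V) (_ : ι → V) => L.1.toFinset where
  mem R := by
    refine (Definable.exists_fact (P := fun R' L (ν : (ι ⊕ Fin (S.arity R)) ⊕ Fin (S.arity R') → V) =>
      ∃ h : R' = R, ∀ i, ν (Sum.inr i) = ν (Sum.inl (Sum.inr (h ▸ i)))) fun R' => ?_).congr
      fun L ν => ?_
    · by_cases h : R' = R
      · subst h
        exact (Definable.forall_finite fun i => definable_eq (Sum.inr i) (Sum.inl (Sum.inr i))).congr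
          fun L ν => by simp
      · exact (definable_const False).congr fun L ν => by simp [h]
    · rw [List.mem_toFinset]
      constructor
      · rintro ⟨⟨R', y⟩, hf, h, hy⟩
        dsimp only at h
        subst h
        convert! hf using 2
        exact funext fun i => (hy i).symm
      · exact fun h => ⟨_, h, rfl, fun i => rfl⟩
  value_mem L ν f hf i := .inl ⟨f, List.mem_toFinset.1 hf, i, rfl⟩

theorem DefInst.mem_of {C : Finset V} {ι κ : Type} {F : RawInput S V → (ι → V) → S.Inst V}
    (hF : DefInst enc C F) (R : S.Rel) (g : ι → κ) (t : Fin (S.arity R) → κ) :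
    Definable enc fun L (ν : κ → V) => (⟨R, ν ∘ t⟩ : S.Fact V) ∈ F L (ν ∘ g) :=
  (hF.mem R).rename (Sum.elim g t)

theorem DefInst.definable_activeDomain {C : Finset V} {ι : Type} [Finite ι]
    {F : RawInput S V → (ι → V) → S.Inst V} (hF : DefInst enc C F) :
    Definable enc fun L (ν : Option ι → V) => ν none ∈ activeDomain (F L (ν ∘ some)) := by
  refine (Definable.exists_finite fun R : S.Rel =>
    ((hF.mem_of R (Sum.inl ∘ some) Sum.inr).and (Definable.exists_finite fun i : Fin (S.arity R) =>
      definable_eq (Sum.inr i) (Sum.inl none))).exists_values C).congr fun L ν => ?_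
  constructor
  · rintro ⟨R, y, _, hy, i, hi⟩
    exact ⟨_, hy, i, hi⟩
  · rintro ⟨f, hf, i, hi⟩
    refine ⟨f.1, f.2, fun j => ?_, hf, i, hi⟩
    rcases hF.value_mem _ _ f hf j with h | h | ⟨k, h⟩
    · exact .inl h
    · exact .inr (.inl h)
    · exact .inr (.inr ⟨some k, h⟩)

theorem Definable.term {ι : Type} {n : ℕ} {P : RawInput S V → (Option ι → V) → Prop}
    (h : Definable enc P) (g : Fin n → ι) (t : DBTerm V n) :
    Definable enc fun L (ν : ι → V) => P L (extendEnv ν (t.eval (ν ∘ g))) := by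
  cases t with
  | var x =>
    refine (h.rename fun o => o.elim (g x) id).congr fun L ν => ?_
    refine iff_of_eq (congrArg (P L) (funext fun o => ?_))
    cases o <;> rfl
  | const c => exact h.const c

theorem definable_comp {ι : Type} {n : ℕ} (op : CompOp) (g : Fin n → ι) (s t : DBTerm V n) :
    Definable enc fun (_ : RawInput S V) (ν : ι → V) =>
      op.Holds (s.eval (ν ∘ g)) (t.eval (ν ∘ g)) := by
  have key : ∀ op : CompOp, Definable enc fun (_ : RawInput S V) (ν : Option (Option ι) → V) =>
      op.Holds (ν (some none)) (ν none) := by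
    intro op
    cases op with
    | eq => exact definable_eq _ _
    | ne => exact (definable_eq _ _).not
    | lt => exact definable_lt _ _
    | le => exact (definable_lt none (some none)).not.congr fun L ν => not_lt
  exact ((key op).term (some ∘ g) t).term g s

/-- Truth of formulas in definable instances is definable. -/
theorem DefInst.definable_holds {C : Finset V} {ι : Type} [Finite ι]
    {F : RawInput S V → (ι → V) → S.Inst V} (hF : DefInst enc C F)
    {A : RawInput S V → (ι → V) → Set V}
    (hA : Definable enc fun L (ν : Option ι → V) => ν none ∈ A L (ν ∘ some))
    (hAC : ∀ L ν, A L ν ⊆ valueDom C L ν) {n : ℕ} (φ : FOQuery S V n) :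
    Definable enc fun L (ν : ι ⊕ Fin n → V) =>
      φ.Holds (F L (ν ∘ Sum.inl)) (A L (ν ∘ Sum.inl)) (ν ∘ Sum.inr) := by
  induction φ with
  | @atom n R ts =>
    -- Membership is definable for tuples of variables only. The terms are therefore replaced by
    -- quantified variables equated with them; if the atom holds, its values lie in the range of
    -- these quantifiers.
    have h1 := fun i : Fin (S.arity R) => (definable_eq (enc := enc) (S := S) (V := V)
      (ι := Option ((ι ⊕ Fin n) ⊕ Fin (S.arity R))) (some (Sum.inr i)) none).term
      (Sum.inl ∘ Sum.inr) (ts i)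
    refine (((Definable.forall_finite h1).and
      (hF.mem_of R (Sum.inl ∘ Sum.inl) Sum.inr)).exists_values C).congr fun L ν => ?_
    constructor
    · rintro ⟨y, _, h, hy⟩
      have : y = fun i => (ts i).eval (ν ∘ Sum.inr) := funext h
      subst this
      exact hy
    · intro h
      refine ⟨fun i => (ts i).eval (ν ∘ Sum.inr), fun i => ?_, fun i => rfl, h⟩
      rcases hF.value_mem _ _ _ h i with h | h | ⟨k, h⟩
      · exact .inl h
      · exact .inr (.inl h)
      · exact .inr (.inr ⟨Sum.inl k, h⟩)
  | comp op s t => exact definable_comp op Sum.inr s t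
  | not φ ih => exact ih.not
  | and φ ψ ihφ ihψ => exact ihφ.and ihψ
  | @all n φ ih =>
    have h1 := ih.rename (κ := Option (ι ⊕ Fin n)) (Sum.elim (some ∘ Sum.inl)
      (Fin.lastCases (motive := fun _ => Option (ι ⊕ Fin n)) none fun i => some (Sum.inr i)))
    have h2 := hA.rename (κ := Option (ι ⊕ Fin n)) (Option.map Sum.inl)
    refine ((h2.and h1.not).exists_value C).not.congr fun L ν => ?_
    have key : ∀ v : V, (extendEnv ν v ∘ Sum.elim (some ∘ Sum.inl)
        (Fin.lastCases (motive := fun _ => Option (ι ⊕ Fin n)) none fun i => some (Sum.inr i))) ∘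
        Sum.inr = Fin.snoc (α := fun _ => V) (ν ∘ Sum.inr) v := by
      intro v
      funext i
      refine Fin.lastCases ?_ (fun i => ?_) i
      · simp [extendEnv]
      · simp [extendEnv]
    simp only [key]
    constructor
    · intro h a ha
      by_contra hφ
      refine h ⟨a, ?_, ha, hφ⟩
      rcases hAC _ _ ha with h | h | ⟨k, h⟩
      · exact .inl h
      · exact .inr (.inl h)
      · exact .inr (.inr ⟨Sum.inl k, h⟩)
    · rintro h ⟨a, _, ha, hφ⟩
      exact hφ (h a ha)

theorem definable_mem_consts {ι : Type} {X : Set V} {C : Finset V} (hX : X ⊆ C) (i : ι) :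
    Definable enc fun (_ : RawInput S V) (ν : ι → V) => ν i ∈ X := by
  refine (Definable.exists_finset (P := fun c (_ : RawInput S V) (ν : ι → V) => c ∈ X ∧ ν i = c)
    (fun c => (definable_const _).and (definable_eq_const i c)) C).congr fun L ν => ?_
  constructor
  · rintro ⟨c, _, hc, rfl⟩
    exact hc
  · exact fun h => ⟨_, hX h, h, rfl⟩

theorem DefInst.definable_quantDomain {C : Finset V} {ι : Type} [Finite ι]
    {F : RawInput S V → (ι → V) → S.Inst V} (hF : DefInst enc C F) {X : Set V} (hX : X ⊆ C) :
    (Definable enc fun L (ν : Option ι → V) => ν none ∈ activeDomain (F L (ν ∘ some)) ∪ X) ∧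
      ∀ L ν, activeDomain (F L ν) ∪ X ⊆ valueDom C L ν := by
  refine ⟨hF.definable_activeDomain.or (definable_mem_consts hX none), fun L ν v hv => ?_⟩
  rcases hv with ⟨f, hf, i, rfl⟩ | hv
  · exact hF.value_mem L ν f hf i
  · exact .inr (.inl (hX hv))

theorem DefInst.definable_sat {C : Finset V} {ι : Type} [Finite ι]
    {F : RawInput S V → (ι → V) → S.Inst V} (hF : DefInst enc C F) (Q : BoolQuery S V)
    (hQ : FOQuery.consts Q ⊆ C) : Definable enc fun L ν => Q.Sat (F L ν) := by
  obtain ⟨h1, h2⟩ := hF.definable_quantDomain hQ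
  refine ((hF.definable_holds h1 h2 Q).rename (κ := ι) (Sum.elim id fun i => i.elim0)).congr
    fun L ν => ?_
  refine iff_of_eq (congrArg _ ?_)
  funext i
  exact i.elim0

theorem Definable.forall_list {α ι : Type} {P : α → RawInput S V → (ι → V) → Prop}
    (h : ∀ x, Definable enc (P x)) (l : List α) :
    Definable enc fun L ν => ∀ x ∈ l, P x L ν := by
  induction l with
  | nil => exact (definable_const True).congr fun _ _ => by simp
  | cons x s ih => exact ((h x).and ih).congr fun _ _ => by simp

theorem DefInst.definable_denial {C : Finset V} {ι : Type} [Finite ι]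
    {F : RawInput S V → (ι → V) → S.Inst V} (hF : DefInst enc C F) (κ : Denial S V)
    (hκ : κ.consts ⊆ C) : Definable enc fun L ν => κ.Sat (F L ν) := by
  obtain ⟨h1, h2⟩ := hF.definable_quantDomain hκ
  have hdom := Definable.forall_finite fun x : Fin κ.nvars =>
    h1.rename (κ := ι ⊕ Fin κ.nvars) fun o => o.elim (Sum.inr x) Sum.inl
  have hatoms := Definable.forall_list (fun a : Σ R : S.Rel, Fin (S.arity R) → DBTerm V κ.nvars =>
    hF.definable_holds h1 h2 (FOQuery.atom a.1 a.2)) κ.atoms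
  have hcomps := Definable.forall_list (fun c : CompOp × DBTerm V κ.nvars × DBTerm V κ.nvars =>
    hF.definable_holds h1 h2 (FOQuery.comp c.1 c.2.1 c.2.2)) κ.comps
  refine ((hdom.and (hatoms.and hcomps)).exists_values C).not.congr fun L ν => ?_
  constructor
  · intro h y hy hbad
    exact h ⟨y, fun j => h2 _ _ (hy j), hy, hbad⟩
  · rintro h ⟨y, _, hy, hbad⟩
    exact h y hy hbad

theorem DefInst.definable_consistent {C : Finset V} {ι : Type} [Finite ι]
    {F : RawInput S V → (ι → V) → S.Inst V} (hF : DefInst enc C F) (IC : List (Denial S V))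
    (hIC : ∀ κ ∈ IC, κ.consts ⊆ C) : Definable enc fun L ν => Consistent IC (F L ν) := by
  have := Definable.forall_list (fun κ : {κ // κ ∈ IC} => hF.definable_denial κ.1 (hIC κ.1 κ.2))
    IC.attach
  exact this.congr fun L ν => by simp [Consistent]

/-! ### Definable changes of instances -/

theorem definable_fact_eq {ι : Type} {R R' : S.Rel} (g : Fin (S.arity R) → ι)
    (g' : Fin (S.arity R') → ι) : Definable enc fun (_ : RawInput S V) (ν : ι → V) =>
      (⟨R, ν ∘ g⟩ : S.Fact V) = ⟨R', ν ∘ g'⟩ := by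
  by_cases h : R = R'
  · subst h
    refine (Definable.forall_finite fun i => definable_eq (g i) (g' i)).congr fun L ν => ?_
    simp [funext_iff]
  · exact (definable_const False).congr fun L ν => by simp [h]

theorem mem_apply {u : ChangeAction S V} {D : S.Inst V} {f : S.Fact V} :
    f ∈ u.apply D ↔
      ((⟨u.rel, u.tuple⟩ : S.Fact V) ∈ D ∧ f = ⟨u.rel, Function.update u.tuple u.attr u.value⟩) ∨
        (f ∈ D ∧ f ≠ ⟨u.rel, u.tuple⟩) := by
  unfold ChangeAction.apply
  split_ifs with h
  · simp [h, and_comm]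
  · simp only [h, false_and, false_or]
    refine ⟨fun hf => ⟨hf, ?_⟩, fun hf => hf.1⟩
    rintro rfl
    exact h hf

theorem DefInst.apply {C : Finset V} {ι : Type} {F : RawInput S V → (ι → V) → S.Inst V}
    (hF : DefInst enc C F) (R : S.Rel) (A : Fin (S.arity R)) :
    DefInst enc C fun L (ν : ι ⊕ Fin (S.arity R + 1) → V) =>
      (⟨R, fun i => ν (Sum.inr i.castSucc), A, ν (Sum.inr (Fin.last _))⟩ :
        ChangeAction S V).apply (F L (ν ∘ Sum.inl)) where
  mem R' := by
    have hold := hF.mem_of (κ := (ι ⊕ Fin (S.arity R + 1)) ⊕ Fin (S.arity R')) R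
      (Sum.inl ∘ Sum.inl) (fun i => Sum.inl (Sum.inr i.castSucc))
    have heq := definable_fact_eq (enc := enc) (S := S) (V := V)
      (ι := (ι ⊕ Fin (S.arity R + 1)) ⊕ Fin (S.arity R')) (R := R') (R' := R)
      Sum.inr (Function.update (fun i => Sum.inl (Sum.inr i.castSucc)) A
        (Sum.inl (Sum.inr (Fin.last _))))
    have hmem := hF.mem_of (κ := (ι ⊕ Fin (S.arity R + 1)) ⊕ Fin (S.arity R')) R'
      (Sum.inl ∘ Sum.inl) Sum.inr
    have hne := (definable_fact_eq (enc := enc) (S := S) (V := V)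
      (ι := (ι ⊕ Fin (S.arity R + 1)) ⊕ Fin (S.arity R')) (R := R') (R' := R)
      Sum.inr (fun i => Sum.inl (Sum.inr i.castSucc))).not
    refine ((hold.and heq).or (hmem.and hne)).congr fun L ν => ?_
    rw [mem_apply]
    refine or_congr (and_congr Iff.rfl ?_) Iff.rfl
    rw [Function.comp_update]
    rfl
  value_mem L ν f hf i := by
    rcases mem_apply.1 hf with ⟨_, rfl⟩ | ⟨h, _⟩
    · have key : ∀ i : Fin (S.arity R), ∃ j, ν j = Function.update
          (fun i : Fin (S.arity R) => ν (Sum.inr i.castSucc)) A (ν (Sum.inr (Fin.last _))) i := by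
        intro i
        by_cases hi : i = A
        · exact ⟨Sum.inr (Fin.last _), by simp [hi]⟩
        · exact ⟨Sum.inr i.castSucc, by simp [hi]⟩
      exact .inr (.inr (key i))
    · exact valueDom_comp_subset _ ν (hF.value_mem L _ f h i)

end DefinableInstances

/-! ### Replacements of boundedly many tuples -/

section Replacements

variable {S : Schema} {V : Type} {k : ℕ}

/-- The positions of `k` tuples of the relations `R`. -/
abbrev Slots (R : Fin k → S.Rel) : Type := Σ j, Fin (S.arity (R j))

/-- The atoms that are given by the values at the positions of `k` tuples. -/
def slotFact (R : Fin k → S.Rel) (y : Slots R → V) (j : Fin k) : S.Fact V := ⟨R j, fun i => y ⟨j, i⟩⟩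

variable [LinearOrder V]

/-- `u` lists distinct atoms of `D` together with the tuples that replace them, and the changes are
admissible. -/
def ValidReplacement (dom : ∀ R : S.Rel, Fin (S.arity R) → Finset V) (D : S.Inst V)
    (R : Fin k → S.Rel) (u : Slots R ⊕ Slots R → V) : Prop :=
  Function.Injective (slotFact R (u ∘ Sum.inl)) ∧ ∀ j, slotFact R (u ∘ Sum.inl) j ∈ D ∧
    ∀ A, u (Sum.inr ⟨j, A⟩) ≠ u (Sum.inl ⟨j, A⟩) → u (Sum.inr ⟨j, A⟩) ∈ dom (R j) A

/-- The instance that results from a replacement. -/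
def replace (D : S.Inst V) (R : Fin k → S.Rel) (u : Slots R ⊕ Slots R → V) : S.Inst V :=
  (D.filter fun f => ∀ j, f ≠ slotFact R (u ∘ Sum.inl) j) ∪
    Finset.univ.image (slotFact R (u ∘ Sum.inr))

/-- The cost of a replacement. -/
noncomputable def replaceCost (dom : ∀ R : S.Rel, Fin (S.arity R) → Finset V)
    (w : ∀ R : S.Rel, Fin (S.arity R) → V → V → ℝ) (R : Fin k → S.Rel)
    (u : Slots R ⊕ Slots R → V) : ℝ :=
  ∑ p : Slots R, if u (Sum.inr p) ∈ dom (R p.1) p.2 ∧ u (Sum.inr p) ≠ u (Sum.inl p) then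
    w (R p.1) p.2 (u (Sum.inl p)) (u (Sum.inr p)) else 0

/-- `Q` is true after each consistent replacement of at most `K` tuples that has minimal cost among
all of them. -/
def TrueAfterOptimalReplacements (IC : List (Denial S V))
    (dom : ∀ R : S.Rel, Fin (S.arity R) → Finset V)
    (w : ∀ R : S.Rel, Fin (S.arity R) → V → V → ℝ) (Q : BoolQuery S V) (K : ℕ) (D : S.Inst V) :
    Prop :=
  ∀ (p : Σ k : Fin (K + 1), Fin k → S.Rel) (u : Slots p.2 ⊕ Slots p.2 → V),
    ValidReplacement dom D p.2 u → Consistent IC (replace D p.2 u) →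
    (∀ (p' : Σ k : Fin (K + 1), Fin k → S.Rel) (u' : Slots p'.2 ⊕ Slots p'.2 → V),
      ValidReplacement dom D p'.2 u' → Consistent IC (replace D p'.2 u') →
      replaceCost dom w p.2 u ≤ replaceCost dom w p'.2 u') →
    Q.Sat (replace D p.2 u)

end Replacements

/-! ### Definable functions with finitely many values -/

section DefinableFunctions

variable {S : Schema} {V : Type} [LinearOrder V] {enc : V ↪o List Bool}

/-- The function `g` has finitely many values, and each of its fibres is definable. -/
def DefinableFun (enc : V ↪o List Bool) {ι β : Type} (g : RawInput S V → (ι → V) → β) : Prop :=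
  (∃ s : Finset β, ∀ L ν, g L ν ∈ s) ∧ ∀ b, Definable enc fun L ν => g L ν = b

theorem DefinableFun.congr {ι β : Type} {g g' : RawInput S V → (ι → V) → β}
    (h : DefinableFun enc g) (hg : ∀ L ν, g L ν = g' L ν) : DefinableFun enc g' := by
  have : g = g' := funext fun L => funext fun ν => hg L ν
  exact this ▸ h

theorem definableFun_const {ι β : Type} (b : β) :
    DefinableFun enc fun (_ : RawInput S V) (_ : ι → V) => b :=
  ⟨⟨{b}, by simp⟩, fun _ => definable_const _⟩

theorem DefinableFun.rename {ι κ β : Type} {g : RawInput S V → (ι → V) → β}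
    (h : DefinableFun enc g) (f : ι → κ) : DefinableFun enc fun L ν => g L (ν ∘ f) := by
  obtain ⟨⟨s, hs⟩, h⟩ := h
  exact ⟨⟨s, fun L ν => hs L _⟩, fun b => (h b).rename f⟩

/-- Only finitely many pairs of arguments occur, so `op` is a finite table built into the test. This
covers sums and comparisons of real numbers without any computation on them. -/
theorem DefinableFun.comp₂ {ι β γ δ : Type} {g : RawInput S V → (ι → V) → β}
    {g' : RawInput S V → (ι → V) → γ} (h : DefinableFun enc g) (h' : DefinableFun enc g')
    (op : β → γ → δ) : DefinableFun enc fun L ν => op (g L ν) (g' L ν) := by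
  classical
  obtain ⟨⟨s, hs⟩, h⟩ := h
  obtain ⟨⟨s', hs'⟩, h'⟩ := h'
  refine ⟨⟨(s ×ˢ s').image fun q => op q.1 q.2, fun L ν => Finset.mem_image.2
    ⟨(g L ν, g' L ν), Finset.mem_product.2 ⟨hs L ν, hs' L ν⟩, rfl⟩⟩, fun b => ?_⟩
  refine (Definable.exists_finset (P := fun (q : β × γ) (L : RawInput S V) ν =>
    (g L ν = q.1 ∧ g' L ν = q.2) ∧ op q.1 q.2 = b)
    (fun q => ((h q.1).and (h' q.2)).and (definable_const _)) (s ×ˢ s')).congr fun L ν => ?_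
  constructor
  · rintro ⟨q, _, ⟨h1, h2⟩, h3⟩
    exact (congrArg₂ op h1 h2).trans h3
  · exact fun hb => ⟨(g L ν, g' L ν), Finset.mem_product.2 ⟨hs L ν, hs' L ν⟩, ⟨rfl, rfl⟩, hb⟩

open Classical in
theorem Definable.definableFun {ι : Type} {P : RawInput S V → (ι → V) → Prop}
    (h : Definable enc P) : DefinableFun enc fun L ν => decide (P L ν) := by
  refine ⟨⟨Finset.univ, fun _ _ => Finset.mem_univ _⟩, fun b => ?_⟩
  cases b with
  | true => exact h.congr fun L ν => by simp
  | false => exact h.not.congr fun L ν => by simp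

theorem DefinableFun.ite {ι β : Type} {P : RawInput S V → (ι → V) → Prop}
    [∀ L ν, Decidable (P L ν)] {g g' : RawInput S V → (ι → V) → β}
    (hP : Definable enc P) (h : DefinableFun enc g) (h' : DefinableFun enc g') :
    DefinableFun enc fun L ν => if P L ν then g L ν else g' L ν :=
  (hP.definableFun.comp₂ (h.comp₂ h' Prod.mk) fun b q => if b then q.1 else q.2).congr
    fun L ν => by by_cases hp : P L ν <;> simp [hp]

theorem DefinableFun.sum {ι α : Type} {g : α → RawInput S V → (ι → V) → ℝ}
    (h : ∀ x, DefinableFun enc (g x)) (s : Finset α) :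
    DefinableFun enc fun L ν => ∑ x ∈ s, g x L ν := by
  classical
  induction s using Finset.induction_on with
  | empty => exact (definableFun_const 0).congr fun L ν => by simp
  | insert x s hx ih =>
    exact ((h x).comp₂ ih (· + ·)).congr fun L ν => by simp [Finset.sum_insert hx]

theorem DefinableFun.definable_le {ι : Type} {g g' : RawInput S V → (ι → V) → ℝ}
    (h : DefinableFun enc g) (h' : DefinableFun enc g') :
    Definable enc fun L ν => g L ν ≤ g' L ν :=
  ((h.comp₂ h' (· ≤ ·)).2 True).congr fun L ν => by simp

theorem definable_mem_finset {ι : Type} (s : Finset V) (i : ι) :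
    Definable enc fun (_ : RawInput S V) (ν : ι → V) => ν i ∈ s :=
  (definable_mem_consts (Set.Subset.refl (s : Set V)) i).congr fun L ν => by simp

theorem definableFun_weight {ι : Type} {dom : Finset V} {w : V → ℝ}
    (hw : ∀ a a', a ∉ dom → a' ∉ dom → w a = w a') (i : ι) :
    DefinableFun enc fun (_ : RawInput S V) (ν : ι → V) => w (ν i) := by
  -- `r` is the common weight of all old values outside the bounded domain, or 0 if there are none.
  obtain ⟨r, hr⟩ : ∃ r, ∀ a, a ∉ dom → w a = r := by
    by_cases h : ∃ a, a ∉ dom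
    · obtain ⟨a, ha⟩ := h
      exact ⟨w a, fun a' ha' => hw _ _ ha' ha⟩
    · exact ⟨0, fun a ha => absurd ⟨a, ha⟩ h⟩
  refine ((DefinableFun.sum (fun c => DefinableFun.ite (definable_eq_const i c)
    (definableFun_const (w c)) (definableFun_const 0)) dom).ite (definable_mem_finset dom i)
    (definableFun_const r)).congr fun L ν => ?_
  by_cases h : ν i ∈ dom
  · simp [h]
  · simp [h, hr _ h]

/-- The test for membership in `dom` inside `replaceCost` matters here: it makes the cost finitely
valued for all `u`, whereas nothing is known about weights of changes to values outside the domain.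
For valid replacements it excludes no change. -/
theorem definableFun_replaceCost {dom : ∀ R : S.Rel, Fin (S.arity R) → Finset V}
    {w : ∀ R : S.Rel, Fin (S.arity R) → V → V → ℝ}
    (hw : ∀ R A a a' b, a ∉ dom R A → a' ∉ dom R A → b ∈ dom R A → w R A a b = w R A a' b)
    {k : ℕ} (R : Fin k → S.Rel) :
    DefinableFun enc fun (_ : RawInput S V) (u : Slots R ⊕ Slots R → V) =>
      replaceCost dom w R u := by
  refine DefinableFun.sum (fun p => ?_) _
  refine (DefinableFun.sum (fun c : {c // c ∈ dom (R p.1) p.2} => DefinableFun.ite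
    ((definable_eq_const (Sum.inr p) c.1).and (definable_eq (Sum.inr p) (Sum.inl p)).not)
    (definableFun_weight (w := fun a => w (R p.1) p.2 a c.1)
      (fun a a' ha ha' => hw _ _ _ _ _ ha ha' c.2) (Sum.inl p)) (definableFun_const 0))
    (dom (R p.1) p.2).attach).congr fun L u => ?_
  rw [Finset.sum_attach (dom (R p.1) p.2) fun c =>
    if u (Sum.inr p) = c ∧ ¬ u (Sum.inr p) = u (Sum.inl p) then
      w (R p.1) p.2 (u (Sum.inl p)) c else 0]
  by_cases h : u (Sum.inr p) = u (Sum.inl p)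
  · simp [h]
  · simp [h]

end DefinableFunctions

/-! ### Definability of optimality among replacements -/

section DefinableReplacements

variable {S : Schema} {V : Type} [LinearOrder V] {enc : V ↪o List Bool} {C : Finset V} {ι : Type}
  {F : RawInput S V → (ι → V) → S.Inst V} {k : ℕ}

/-- The variables for the `j`-th tuple that is replaced. -/
abbrev oldVar (ι : Type) (R : Fin k → S.Rel) (j : Fin k) (i : Fin (S.arity (R j))) :
    ι ⊕ (Slots R ⊕ Slots R) := Sum.inr (Sum.inl ⟨j, i⟩)

/-- The variables for the tuple that replaces the `j`-th tuple. -/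
abbrev newVar (ι : Type) (R : Fin k → S.Rel) (j : Fin k) (i : Fin (S.arity (R j))) :
    ι ⊕ (Slots R ⊕ Slots R) := Sum.inr (Sum.inr ⟨j, i⟩)

theorem DefInst.definable_valid (hF : DefInst enc C F)
    (dom : ∀ R : S.Rel, Fin (S.arity R) → Finset V) (R : Fin k → S.Rel) :
    Definable enc fun L (ν : ι ⊕ (Slots R ⊕ Slots R) → V) =>
      ValidReplacement dom (F L (ν ∘ Sum.inl)) R (ν ∘ Sum.inr) := by
  refine Definable.and ?_ ?_
  · exact Definable.forall_finite fun j => Definable.forall_finite fun j' =>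
      (definable_fact_eq (oldVar ι R j) (oldVar ι R j')).imp (definable_const (j = j'))
  · exact Definable.forall_finite fun j => (hF.mem_of (R j) Sum.inl (oldVar ι R j)).and <|
      Definable.forall_finite fun A =>
        (definable_eq (newVar ι R j A) (oldVar ι R j A)).not.imp
          (definable_mem_finset (dom (R j) A) (newVar ι R j A))

theorem DefInst.replace (hF : DefInst enc C F) (R : Fin k → S.Rel) :
    DefInst enc C fun L (ν : ι ⊕ (Slots R ⊕ Slots R) → V) =>
      replace (F L (ν ∘ Sum.inl)) R (ν ∘ Sum.inr) where
  mem R' := by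
    refine (((hF.mem_of R' (Sum.inl ∘ Sum.inl) Sum.inr).and (Definable.forall_finite fun j =>
      (definable_fact_eq Sum.inr
        (Sum.inl ∘ oldVar ι R j)).not)).or
      (Definable.exists_finite fun j => definable_fact_eq
        (Sum.inl ∘ newVar ι R j) Sum.inr)).congr
      fun L ν => ?_
    simp only [_root_.replace, Finset.mem_union, Finset.mem_filter, Finset.mem_image,
      Finset.mem_univ, true_and]
    rfl
  value_mem L ν f hf i := by
    simp only [_root_.replace, Finset.mem_union, Finset.mem_filter, Finset.mem_image,
      Finset.mem_univ, true_and] at hf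
    rcases hf with ⟨hf, _⟩ | ⟨j, rfl⟩
    · exact valueDom_comp_subset _ ν (hF.value_mem L _ f hf i)
    · exact .inr (.inr ⟨_, rfl⟩)

theorem DefInst.value_mem_of_valid (hF : DefInst enc C F)
    {dom : ∀ R : S.Rel, Fin (S.arity R) → Finset V} (hdom : ∀ R A, dom R A ⊆ C)
    {L : RawInput S V} {ν : ι → V} {R : Fin k → S.Rel} {u : Slots R ⊕ Slots R → V}
    (h : ValidReplacement dom (F L ν) R u) (j : Slots R ⊕ Slots R) : u j ∈ valueDom C L ν := by
  have hold : ∀ j, u (Sum.inl j) ∈ valueDom C L ν := fun j =>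
    hF.value_mem L ν _ (h.2 j.1).1 j.2
  rcases j with j | j
  · exact hold j
  · by_cases hj : u (Sum.inr j) = u (Sum.inl j)
    · exact hj ▸ hold j
    · exact .inr (.inl (hdom _ _ ((h.2 j.1).2 j.2 hj)))

/-- There are finitely many shapes `p` of a replacement, and for each one the unbounded quantifier
over `u` may be restricted to known values by `DefInst.value_mem_of_valid`. -/
theorem DefInst.definable_trueAfterOptimalReplacements [Finite ι] (hF : DefInst enc C F)
    {IC : List (Denial S V)} {Q : BoolQuery S V}
    {dom : ∀ R : S.Rel, Fin (S.arity R) → Finset V}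
    {w : ∀ R : S.Rel, Fin (S.arity R) → V → V → ℝ}
    (hw : ∀ R A a a' b, a ∉ dom R A → a' ∉ dom R A → b ∈ dom R A → w R A a b = w R A a' b)
    (hIC : ∀ κ ∈ IC, κ.consts ⊆ C) (hQ : FOQuery.consts Q ⊆ C) (hdom : ∀ R A, dom R A ⊆ C)
    (K : ℕ) :
    Definable enc fun L ν => TrueAfterOptimalReplacements IC dom w Q K (F L ν) := by
  have hcand := fun p : Σ k : Fin (K + 1), Fin k → S.Rel =>
    (hF.definable_valid dom p.2).and ((hF.replace p.2).definable_consistent IC hIC)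
  have hmin : ∀ p : Σ k : Fin (K + 1), Fin k → S.Rel,
      Definable enc fun L (ν : ι ⊕ (Slots p.2 ⊕ Slots p.2) → V) =>
        ∀ (p' : Σ k : Fin (K + 1), Fin k → S.Rel) (u' : Slots p'.2 ⊕ Slots p'.2 → V),
          ValidReplacement dom (F L (ν ∘ Sum.inl)) p'.2 u' →
          Consistent IC (_root_.replace (F L (ν ∘ Sum.inl)) p'.2 u') →
          replaceCost dom w p.2 (ν ∘ Sum.inr) ≤ replaceCost dom w p'.2 u' := by
    intro p
    refine (Definable.forall_finite fun p' : Σ k : Fin (K + 1), Fin k → S.Rel =>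
      ((((hcand p').rename (κ := (ι ⊕ (Slots p.2 ⊕ Slots p.2)) ⊕ (Slots p'.2 ⊕ Slots p'.2))
        (Sum.map Sum.inl id)).and
        (((definableFun_replaceCost hw p.2).rename (Sum.inl ∘ Sum.inr)).definable_le
          ((definableFun_replaceCost hw p'.2).rename Sum.inr)).not).exists_values C).not).congr
      fun L ν => ?_
    refine forall_congr' fun p' => ?_
    constructor
    · intro h u' h1 h2
      by_contra h3
      exact h ⟨u', fun j => valueDom_comp_subset _ ν (hF.value_mem_of_valid hdom h1 j),
        ⟨h1, h2⟩, h3⟩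
    · rintro h ⟨u', _, ⟨h1, h2⟩, h3⟩
      exact h3 (h u' h1 h2)
  refine (Definable.forall_finite fun p : Σ k : Fin (K + 1), Fin k → S.Rel =>
    (((hcand p).and ((hmin p).and
      ((hF.replace p.2).definable_sat Q hQ).not)).exists_values C).not).congr fun L ν => ?_
  refine forall_congr' fun p => ?_
  constructor
  · intro h u h1 h2 h3
    by_contra h4
    exact h ⟨u, fun j => hF.value_mem_of_valid hdom h1 j, ⟨h1, h2⟩, h3, h4⟩
  · rintro h ⟨u, _, ⟨h1, h2⟩, h3, h4⟩
    exact h4 (h u h1 h2 h3)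

theorem DefInst.definableUpd {P : S.Inst V → Prop}
    (hP : ∀ {ι : Type} [Finite ι] {F : RawInput S V → (ι → V) → S.Inst V}, DefInst enc C F →
      Definable enc fun L ν => P (F L ν)) (m : ℕ) :
    ∀ {ι : Type} [Finite ι] {F : RawInput S V → (ι → V) → S.Inst V}, DefInst enc C F →
      DefinableUpd enc m fun L ν us => P (applyUpdates us (F L ν)) := by
  induction m with
  | zero => exact fun hF => hP hF
  | succ m ih => exact fun hF R A => ih (hF.apply R A)

end DefinableReplacements

/-! ### Attribute-based repairs -/

section RepairTheory

variable {S : Schema} {V : Type}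

/-- For a fixed new value, the old values in the finite domain contribute finitely many weights and
all the others contribute at most one. A finite set of positive reals has a positive lower bound. -/
theorem exists_weight_bounds {dom : ∀ R : S.Rel, Fin (S.arity R) → Finset V}
    {w : ∀ R : S.Rel, Fin (S.arity R) → V → V → ℝ}
    (hw_pos : ∀ R A a b, b ∈ dom R A → a ≠ b → 0 < w R A a b)
    (hw_out : ∀ R A a a' b, a ∉ dom R A → a' ∉ dom R A → b ∈ dom R A → w R A a b = w R A a' b) :
    ∃ δ M : ℝ, 0 < δ ∧ 0 ≤ M ∧
      ∀ R A a b, b ∈ dom R A → a ≠ b → δ ≤ w R A a b ∧ w R A a b ≤ M := by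
  set X : Set ℝ := {x | ∃ R A a b, b ∈ dom R A ∧ a ≠ b ∧ w R A a b = x} with hX
  have hfin : X.Finite := by
    have : (⋃ R, ⋃ A : Fin (S.arity R), ⋃ b ∈ dom R A, Set.range fun a => w R A a b).Finite := by
      refine Set.finite_iUnion fun R => Set.finite_iUnion fun A =>
        (dom R A).finite_toSet.biUnion fun b hb => ?_
      rw [← Set.image_univ, ← Set.union_compl_self (dom R A : Set V), Set.image_union]
      refine ((dom R A).finite_toSet.image _).union (Set.Subsingleton.finite ?_)
      rintro _ ⟨a, ha, rfl⟩ _ ⟨a', ha', rfl⟩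
      exact hw_out R A a a' b ha ha' hb
    refine this.subset ?_
    rintro x ⟨R, A, a, b, hb, _, rfl⟩
    simp only [Set.mem_iUnion]
    exact ⟨R, A, b, hb, a, rfl⟩
  obtain ⟨M, hM⟩ := hfin.bddAbove
  obtain ⟨δ, hδ, hδX⟩ : ∃ δ : ℝ, 0 < δ ∧ ∀ x ∈ X, δ ≤ x := by
    rcases X.eq_empty_or_nonempty with h | h
    · exact ⟨1, one_pos, by simp [h]⟩
    · obtain ⟨x, hx, hmin⟩ := Set.exists_min_image X id hfin h
      refine ⟨x, ?_, hmin⟩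
      obtain ⟨R, A, a, b, hb, hab, rfl⟩ := hx
      exact hw_pos R A a b hb hab
  refine ⟨δ, max M 0, hδ, le_max_right _ _, fun R A a b hb hab => ?_⟩
  have hx : w R A a b ∈ X := ⟨R, A, a, b, hb, hab, rfl⟩
  exact ⟨hδX _ hx, (hM hx).trans (le_max_left _ _)⟩

variable [LinearOrder V]

/-- A violation needs only the presence of atoms, and passing to a subset also shrinks the active
domain. -/
theorem Consistent.mono {IC : List (Denial S V)} {D D' : S.Inst V} (h : Consistent IC D)
    (hD : D' ⊆ D) : Consistent IC D' := by
  intro κ hκ ν hν hbad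
  refine h κ hκ ν (fun x => ?_) ⟨fun a ha => hD (hbad.1 a ha), hbad.2⟩
  rcases hν x with ⟨f, hf, i, hi⟩ | hx
  · exact .inl ⟨f, hD hf, i, hi⟩
  · exact .inr hx

/-- The number of attribute values of `D` that `μ` changes. -/
def Modification.changes (μ : Modification S V) (D : S.Inst V) : ℕ :=
  ∑ f ∈ D, (Finset.univ.filter fun A => μ f.1 f.2 A ≠ f.2 A).card

theorem card_filter_ne_le_changes (μ : Modification S V) (D : S.Inst V) :
    (D.filter fun f => μ f.1 f.2 ≠ f.2).card ≤ μ.changes D := by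
  rw [Finset.card_filter]
  refine Finset.sum_le_sum fun f _ => ?_
  split_ifs with h
  · obtain ⟨A, hA⟩ := Function.ne_iff.1 h
    exact Finset.card_pos.2 ⟨A, by simpa using hA⟩
  · exact Nat.zero_le _

section Costs

variable {dom : ∀ R : S.Rel, Fin (S.arity R) → Finset V}
  {w : ∀ R : S.Rel, Fin (S.arity R) → V → V → ℝ} {δ M : ℝ}

theorem Modification.cost_bounds
    (hw : ∀ R A a b, b ∈ dom R A → a ≠ b → δ ≤ w R A a b ∧ w R A a b ≤ M)
    {μ : Modification S V} {D : S.Inst V} (h : μ.Admissible dom D) :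
    μ.changes D * δ ≤ μ.cost w D ∧ μ.cost w D ≤ μ.changes D * M := by
  have key : ∀ c : ℝ, (μ.changes D : ℝ) * c =
      ∑ f ∈ D, ∑ A, if μ f.1 f.2 A = f.2 A then 0 else c := by
    intro c
    rw [Modification.changes, Nat.cast_sum, Finset.sum_mul]
    refine Finset.sum_congr rfl fun f _ => ?_
    simp only [← ite_not (p := _ = _)]
    rw [← Finset.sum_filter, Finset.sum_const, nsmul_eq_mul]
  rw [key, key]
  constructor
  · refine Finset.sum_le_sum fun f hf => Finset.sum_le_sum fun A _ => ?_
    split_ifs with hA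
    · exact le_rfl
    · exact (hw _ _ _ _ (h f hf A hA) (Ne.symm hA)).1
  · refine Finset.sum_le_sum fun f hf => Finset.sum_le_sum fun A _ => ?_
    split_ifs with hA
    · exact le_rfl
    · exact (hw _ _ _ _ (h f hf A hA) (Ne.symm hA)).2

/-- Updates of values in the bounded domains can be undone, up to tuples that have been merged. -/
theorem exists_undo (D : S.Inst V) (us : List (ChangeAction S V))
    (hus : ∀ u ∈ us, u.tuple u.attr ∈ dom u.rel u.attr) :
    ∃ μ : Modification S V, μ.Admissible dom (applyUpdates us D) ∧
      μ.result (applyUpdates us D) ⊆ D ∧ μ.changes (applyUpdates us D) ≤ us.length := by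
  induction us using List.reverseRecOn with
  | nil =>
    refine ⟨fun _ t => t, fun f _ A h => absurd rfl h, ?_, ?_⟩
    · simp [applyUpdates, Modification.result]
    · simp [Modification.changes]
  | append_singleton us u ih =>
    obtain ⟨μ, hadm, hres, hch⟩ := ih fun u hu => hus u (by simp [hu])
    have hu := hus u (by simp)
    have happ : applyUpdates (us ++ [u]) D = u.apply (applyUpdates us D) := by
      simp [applyUpdates]
    rw [happ]
    set E := applyUpdates us D
    have hsub : ∀ E' ⊆ E, μ.Admissible dom E' ∧ μ.result E' ⊆ D ∧
        μ.changes E' ≤ (us ++ [u]).length := fun E' hE' =>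
      ⟨fun f hf => hadm f (hE' hf), (Finset.image_subset_image hE').trans hres,
        (Finset.sum_le_sum_of_subset hE').trans (hch.trans (by simp))⟩
    unfold ChangeAction.apply
    split_ifs with hmem
    swap
    · exact ⟨μ, hsub E subset_rfl⟩
    obtain ⟨R, t, A, a⟩ := u
    dsimp only at hu hmem ⊢
    set t' := Function.update t A a with ht'
    -- If the new tuple is already stored, the action merges two tuples. Then the instance only
    -- loses an atom, and the old modification still works.
    by_cases hin : (⟨R, t'⟩ : S.Fact V) ∈ E.erase ⟨R, t⟩
    · rw [Finset.insert_eq_of_mem hin]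
      exact ⟨μ, hsub _ (Finset.erase_subset _ _)⟩
    -- The updated tuple is sent to where its predecessor went. Only at the attribute `A` can this
    -- be a new change; if `μ` left that value alone, the value restored is `t A`, which belongs to
    -- the bounded domain.
    set μ' : Modification S V := Function.update μ R (Function.update (μ R) t' (μ R t)) with hμ'
    have hnew : μ' R t' = μ R t := by simp [hμ']
    have hold : ∀ f ∈ E.erase (⟨R, t⟩ : S.Fact V), μ' f.1 f.2 = μ f.1 f.2 := by
      rintro ⟨R', s⟩ hf
      by_cases hR : R' = R
      · subst hR
        have hs : s ≠ t' := by
          rintro rfl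
          exact hin hf
        simp [hμ', hs]
      · simp [hμ', hR]
    have hval : ∀ B : Fin (S.arity R), μ' R t' B ≠ t' B → μ' R t' B ∈ dom R B := by
      intro B hB
      rw [hnew] at hB ⊢
      by_cases hBt : μ R t B = t B
      · by_cases hBA : B = A
        · rw [hBt, hBA]
          exact hu
        · exact absurd (by rw [hBt, ht', Function.update_of_ne hBA]) hB
      · exact hadm ⟨R, t⟩ hmem B hBt
    refine ⟨μ', ?_, ?_, ?_⟩
    · intro f hf B hB
      rcases Finset.mem_insert.1 hf with rfl | hf
      · exact hval B hB
      · rw [hold f hf] at hB ⊢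
        exact hadm f (Finset.mem_of_mem_erase hf) B hB
    · intro f hf
      obtain ⟨f', hf', rfl⟩ := Finset.mem_image.1 hf
      rcases Finset.mem_insert.1 hf' with rfl | hf'
      · dsimp only
        rw [hnew]
        exact hres (Finset.mem_image.2 ⟨⟨R, t⟩, hmem, rfl⟩)
      · rw [hold f' hf']
        exact hres (Finset.mem_image.2 ⟨f', Finset.mem_of_mem_erase hf', rfl⟩)
    · have hcard : (Finset.univ.filter fun B => μ R t B ≠ t' B).card ≤
          (Finset.univ.filter fun B => μ R t B ≠ t B).card + 1 := by
        refine (Finset.card_le_card (t := insert A (Finset.univ.filter fun B => μ R t B ≠ t B))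
          fun B hB => ?_).trans (Finset.card_insert_le _ _)
        simp only [Finset.mem_filter, Finset.mem_univ, true_and, Finset.mem_insert] at hB ⊢
        by_cases hBA : B = A
        · exact .inl hBA
        · right
          rwa [ht', Function.update_of_ne hBA] at hB
      rw [Modification.changes, Finset.sum_insert hin]
      dsimp only
      rw [hnew, Finset.sum_congr rfl (g := fun f : S.Fact V =>
        (Finset.univ.filter fun A => μ f.1 f.2 A ≠ f.2 A).card) fun f hf => by rw [hold f hf]]
      have := Finset.add_sum_erase E (fun f : S.Fact V =>
        (Finset.univ.filter fun A => μ f.1 f.2 A ≠ f.2 A).card) hmem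
      rw [Modification.changes, ← this] at hch
      dsimp only at hch
      simp only [List.length_append, List.length_singleton]
      omega

theorem cost_nonneg (hw_pos : ∀ R A a b, b ∈ dom R A → a ≠ b → 0 < w R A a b)
    {μ : Modification S V} {D : S.Inst V} (h : μ.Admissible dom D) : 0 ≤ μ.cost w D := by
  refine Finset.sum_nonneg fun f hf => Finset.sum_nonneg fun A _ => ?_
  split_ifs with hA
  · exact le_rfl
  · exact (hw_pos _ _ _ _ (h f hf A hA) (Ne.symm hA)).le

theorem attrDist_le_cost (hw_pos : ∀ R A a b, b ∈ dom R A → a ≠ b → 0 < w R A a b)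
    {μ : Modification S V} {D : S.Inst V} (h : μ.Admissible dom D) :
    attrDist dom w D (μ.result D) ≤ μ.cost w D :=
  csInf_le ⟨0, by rintro _ ⟨μ', hμ', _, rfl⟩; exact cost_nonneg hw_pos hμ'⟩ ⟨μ, h, rfl, rfl⟩

theorem exists_cost_eq_attrDist {D D' : S.Inst V} (h : Reachable dom D D') :
    ∃ μ : Modification S V, μ.Admissible dom D ∧ μ.result D = D' ∧
      μ.cost w D = attrDist dom w D D' := by
  have hne : {c | ∃ μ : Modification S V, μ.Admissible dom D ∧ μ.result D = D' ∧
      μ.cost w D = c}.Nonempty := by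
    obtain ⟨μ, h1, h2⟩ := h
    exact ⟨_, μ, h1, h2, rfl⟩
  have hfin : {c | ∃ μ : Modification S V, μ.Admissible dom D ∧ μ.result D = D' ∧
      μ.cost w D = c}.Finite := by
    classical
    -- The cost depends only on the induced map from `D` to `D'`, and there are finitely many such
    -- maps, so the infimum is attained. Maps that do not preserve relation names receive the
    -- default 0.
    set φ : (D → D') → ℝ := fun g => ∑ f : D, ∑ A : Fin (S.arity f.1.1),
      if h : (g f).1.1 = f.1.1 then
        if (g f).1.2 (h ▸ A) = f.1.2 A then 0 else w f.1.1 A (f.1.2 A) ((g f).1.2 (h ▸ A))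
      else 0
    refine (Set.finite_range φ).subset ?_
    rintro _ ⟨μ, _, hres, rfl⟩
    refine ⟨fun f => ⟨⟨f.1.1, μ f.1.1 f.1.2⟩,
      hres ▸ Finset.mem_image.2 ⟨f.1, f.2, rfl⟩⟩, ?_⟩
    simp only [φ, dite_true]
    exact Finset.sum_coe_sort D fun f =>
      ∑ A, if μ f.1 f.2 A = f.2 A then 0 else w f.1 A (f.2 A) (μ f.1 f.2 A)
  exact hne.csInf_mem hfin

theorem isARepair_iff (hw_pos : ∀ R A a b, b ∈ dom R A → a ≠ b → 0 < w R A a b)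
    {IC : List (Denial S V)} {D D' : S.Inst V} :
    IsARepair IC dom w D D' ↔ ∃ μ : Modification S V, μ.Admissible dom D ∧ μ.result D = D' ∧
      Consistent IC D' ∧ ∀ μ' : Modification S V, μ'.Admissible dom D →
        Consistent IC (μ'.result D) → μ.cost w D ≤ μ'.cost w D := by
  constructor
  · rintro ⟨hr, hc, hmin⟩
    obtain ⟨μ, h1, h2, h3⟩ := exists_cost_eq_attrDist (w := w) hr
    refine ⟨μ, h1, h2, hc, fun μ' h1' hc' => ?_⟩
    rw [h3]
    refine le_trans ?_ (attrDist_le_cost hw_pos h1')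
    by_contra hlt
    exact hmin ⟨_, ⟨μ', h1', rfl⟩, hc', not_le.1 hlt⟩
  · rintro ⟨μ, h1, rfl, hc, hmin⟩
    refine ⟨⟨μ, h1, rfl⟩, hc, ?_⟩
    rintro ⟨D'', hr, hc'', hlt⟩
    obtain ⟨μ', h1', rfl, h3'⟩ := exists_cost_eq_attrDist (w := w) hr
    have := hmin μ' h1' hc''
    have := attrDist_le_cost hw_pos h1
    linarith

/-! ### Modifications and replacements -/

/-- Common core of both translations between modifications and replacements. Distinctness of the
replaced atoms turns the cost over `D` into a sum over slots, and the unchanged atoms contribute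
nothing. -/
theorem ValidReplacement.modification {k : ℕ} {R : Fin k → S.Rel} {D : S.Inst V}
    {u : Slots R ⊕ Slots R → V} (hu : ValidReplacement dom D R u) {μ : Modification S V}
    (hslot : ∀ j, μ (R j) (slotFact R (u ∘ Sum.inl) j).2 = (slotFact R (u ∘ Sum.inr) j).2)
    (hrest : ∀ f ∈ D, (∀ j, f ≠ slotFact R (u ∘ Sum.inl) j) → μ f.1 f.2 = f.2) :
    μ.Admissible dom D ∧ μ.result D = replace D R u ∧ μ.cost w D = replaceCost dom w R u := by
  have hslot' : ∀ j A, μ (R j) (fun i => u (Sum.inl ⟨j, i⟩)) A = u (Sum.inr ⟨j, A⟩) :=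
    fun j A => congrFun (hslot j) A
  have hadm : ∀ j (A : Fin (S.arity (R j))),
      μ (R j) (fun i => u (Sum.inl ⟨j, i⟩)) A ≠ u (Sum.inl ⟨j, A⟩) →
      μ (R j) (fun i => u (Sum.inl ⟨j, i⟩)) A ∈ dom (R j) A := fun j A hA => by
    rw [hslot'] at hA ⊢
    exact (hu.2 j).2 A hA
  have hcost : ∀ j (A : Fin (S.arity (R j))),
      (if μ (R j) (fun i => u (Sum.inl ⟨j, i⟩)) A = u (Sum.inl ⟨j, A⟩) then 0 else
        w (R j) A (u (Sum.inl ⟨j, A⟩)) (μ (R j) (fun i => u (Sum.inl ⟨j, i⟩)) A)) =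
      if u (Sum.inr ⟨j, A⟩) ∈ dom (R j) A ∧ u (Sum.inr ⟨j, A⟩) ≠ u (Sum.inl ⟨j, A⟩) then
        w (R j) A (u (Sum.inl ⟨j, A⟩)) (u (Sum.inr ⟨j, A⟩)) else 0 := fun j A => by
    rw [hslot']
    by_cases h : u (Sum.inr ⟨j, A⟩) = u (Sum.inl ⟨j, A⟩)
    · simp [h]
    · simp [h, (hu.2 j).2 A h]
  refine ⟨fun f hf A hA => ?_, ?_, ?_⟩
  · by_cases h : ∀ j, f ≠ slotFact R (u ∘ Sum.inl) j
    · exact absurd (congrFun (hrest f hf h) A) hA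
    · push Not at h
      obtain ⟨j, rfl⟩ := h
      exact hadm j A hA
  · ext f
    simp only [Modification.result, replace, Finset.mem_image, Finset.mem_union,
      Finset.mem_filter, Finset.mem_univ, true_and]
    constructor
    · rintro ⟨g, hg, rfl⟩
      by_cases h : ∀ j, g ≠ slotFact R (u ∘ Sum.inl) j
      · left
        rw [hrest g hg h]
        exact ⟨hg, h⟩
      · push Not at h
        obtain ⟨j, rfl⟩ := h
        right
        exact ⟨j, congrArg (Sigma.mk (R j)) (hslot j).symm⟩
    · rintro (⟨hf, h⟩ | ⟨j, rfl⟩)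
      · exact ⟨f, hf, by rw [hrest f hf h]⟩
      · exact ⟨_, (hu.2 j).1, congrArg (Sigma.mk (R j)) (hslot j)⟩
  · have hsub : Finset.univ.image (slotFact R (u ∘ Sum.inl)) ⊆ D := by
      intro f hf
      obtain ⟨j, _, rfl⟩ := Finset.mem_image.1 hf
      exact (hu.2 j).1
    rw [Modification.cost, ← Finset.sum_subset hsub, Finset.sum_image fun i _ j _ h => hu.1 h,
      replaceCost, Fintype.sum_sigma]
    · exact Finset.sum_congr rfl fun j _ => Finset.sum_congr rfl fun A _ => hcost j A
    · intro f hf hfu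
      refine Finset.sum_eq_zero fun A _ => ?_
      rw [hrest f hf fun j hj => hfu (hj ▸ Finset.mem_image_of_mem _ (Finset.mem_univ j)),
        if_pos rfl]

theorem ValidReplacement.exists_modification {k : ℕ} {R : Fin k → S.Rel} {D : S.Inst V}
    {u : Slots R ⊕ Slots R → V} (hu : ValidReplacement dom D R u) :
    ∃ μ : Modification S V,
      μ.Admissible dom D ∧ μ.result D = replace D R u ∧ μ.cost w D = replaceCost dom w R u := by
  have hex : ∀ (R' : S.Rel) (t : S.Tuple V R'), ∃ t' : S.Tuple V R',
      (∀ j, slotFact R (u ∘ Sum.inl) j = ⟨R', t⟩ → slotFact R (u ∘ Sum.inr) j = ⟨R', t'⟩) ∧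
      ((∀ j, (⟨R', t⟩ : S.Fact V) ≠ slotFact R (u ∘ Sum.inl) j) → t' = t) := by
    intro R' t
    by_cases h : ∃ j, slotFact R (u ∘ Sum.inl) j = ⟨R', t⟩
    · obtain ⟨j, hj⟩ := h
      obtain rfl : R j = R' := congrArg Sigma.fst hj
      refine ⟨(slotFact R (u ∘ Sum.inr) j).2, fun j' hj' => ?_, fun h => absurd hj.symm (h j)⟩
      obtain rfl : j' = j := hu.1 (hj'.trans hj.symm)
      rfl
    · push Not at h
      exact ⟨t, fun j hj => absurd hj (h j), fun _ => rfl⟩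
  choose μ hμ using hex
  refine ⟨μ, hu.modification (fun j => ?_) fun f _ h => (hμ f.1 f.2).2 h⟩
  have := (hμ (R j) (slotFact R (u ∘ Sum.inl) j).2).1 j rfl
  exact (eq_of_heq (Sigma.mk.inj this).2).symm

theorem Modification.exists_replacement {K : ℕ} {D : S.Inst V} {μ : Modification S V}
    (h : μ.Admissible dom D) (hK : (D.filter fun f => μ f.1 f.2 ≠ f.2).card ≤ K) :
    ∃ (p : Σ k : Fin (K + 1), Fin k → S.Rel) (u : Slots p.2 ⊕ Slots p.2 → V),
      ValidReplacement dom D p.2 u ∧ μ.result D = replace D p.2 u ∧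
        μ.cost w D = replaceCost dom w p.2 u := by
  set X := D.filter fun f => μ f.1 f.2 ≠ f.2 with hX
  set e : Fin X.card ≃ X := X.equivFin.symm
  have hmem : ∀ j, (e j : S.Fact V) ∈ D := fun j => (Finset.mem_filter.1 (e j).2).1
  set p : Σ k : Fin (K + 1), Fin k → S.Rel :=
    ⟨⟨X.card, Nat.lt_succ_of_le hK⟩, fun j => (e j).1.1⟩ with hp
  set u : Slots p.2 ⊕ Slots p.2 → V := Sum.elim (fun q => (e q.1).1.2 q.2)
    fun q => μ (e q.1).1.1 (e q.1).1.2 q.2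
  have hu : ValidReplacement dom D p.2 u := by
    refine ⟨fun i j hij => e.injective (Subtype.ext hij), fun j => ⟨hmem j, fun A hA => ?_⟩⟩
    exact h _ (hmem j) A hA
  obtain ⟨_, h2, h3⟩ := hu.modification (w := w) (μ := μ) (fun j => rfl) fun f hf hfu => by
    by_contra hne
    have hfX : f ∈ X := Finset.mem_filter.2 ⟨hf, hne⟩
    refine hfu (e.symm ⟨f, hfX⟩) ?_
    change f = (e (e.symm ⟨f, hfX⟩)).1
    rw [Equiv.apply_symm_apply]
  exact ⟨p, u, hu, h2, h3⟩

/-- After boundedly many updates, boundedly many tuples have to be considered. -/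
theorem exists_consistentAnswerYes_iff (IC : List (Denial S V)) (Q : BoolQuery S V)
    (hw_pos : ∀ R A a b, b ∈ dom R A → a ≠ b → 0 < w R A a b)
    (hw_out : ∀ R A a a' b, a ∉ dom R A → a' ∉ dom R A → b ∈ dom R A → w R A a b = w R A a' b)
    (m : ℕ) :
    ∃ K, ∀ (D : S.Inst V) (us : List (ChangeAction S V)), Consistent IC D → us.length = m →
      (∀ u ∈ us, u.tuple u.attr ∈ dom u.rel u.attr) →
      (ConsistentAnswerYes IC dom w Q (applyUpdates us D) ↔
        TrueAfterOptimalReplacements IC dom w Q K (applyUpdates us D)) := by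
  obtain ⟨δ, M, hδ, hM, hw⟩ := exists_weight_bounds hw_pos hw_out
  -- Undoing the updates costs at most `m * M` and each change costs at least `δ`, so whatever is no
  -- more expensive than undoing makes at most `m * M / δ` changes.
  refine ⟨max m ⌈m * M / δ⌉₊, fun D us hD hm hus => ?_⟩
  set K := max m ⌈m * M / δ⌉₊ with hK
  obtain ⟨μ₀, hadm, hres, hch⟩ := exists_undo D us hus
  rw [hm] at hch
  set E := applyUpdates us D
  have hcons : Consistent IC (μ₀.result E) := hD.mono hres
  have hcost : μ₀.cost w E ≤ m * M := (Modification.cost_bounds hw hadm).2.trans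
    (mul_le_mul_of_nonneg_right (by exact_mod_cast hch) hM)
  have hfew : ∀ μ : Modification S V, μ.Admissible dom E → μ.cost w E ≤ μ₀.cost w E →
      (E.filter fun f => μ f.1 f.2 ≠ f.2).card ≤ K := by
    intro μ hμ hle
    have h1 := (Modification.cost_bounds hw hμ).1
    have h2 : (μ.changes E : ℝ) ≤ m * M / δ := by
      rw [le_div_iff₀ hδ]
      linarith
    have h3 : μ.changes E ≤ ⌈m * M / δ⌉₊ := by
      exact_mod_cast h2.trans (Nat.le_ceil _)
    exact (card_filter_ne_le_changes μ E).trans (h3.trans (le_max_right _ _))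
  constructor
  · intro h p u hu hc hmin
    obtain ⟨μ, h1, h2, h3⟩ := hu.exists_modification (w := w)
    refine h _ ((isARepair_iff hw_pos).2 ⟨μ, h1, h2, hc, fun μ' h1' hc' => ?_⟩)
    rw [h3]
    -- A competitor no dearer than undoing is itself a replacement of at most `K` tuples. For a
    -- dearer one it suffices to compare with undoing, which is such a replacement too.
    rcases le_total (μ'.cost w E) (μ₀.cost w E) with hle | hle
    · obtain ⟨p', u', hu', h2', h3'⟩ := Modification.exists_replacement (w := w) h1'
        (hfew μ' h1' hle)
      rw [h3']
      exact hmin p' u' hu' (h2' ▸ hc')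
    · refine le_trans ?_ hle
      obtain ⟨p', u', hu', h2', h3'⟩ := Modification.exists_replacement (w := w) hadm
        (hfew μ₀ hadm le_rfl)
      rw [h3']
      exact hmin p' u' hu' (h2' ▸ hcons)
  · intro h D' hD'
    obtain ⟨μ, h1, rfl, hc, hmin⟩ := (isARepair_iff hw_pos).1 hD'
    obtain ⟨p, u, hu, h2, h3⟩ := Modification.exists_replacement (w := w) h1
      (hfew μ h1 (hmin μ₀ hadm hcons))
    rw [h2]
    refine h p u hu (h2 ▸ hc) fun p' u' hu' hc' => ?_
    obtain ⟨μ', h1', h2', h3'⟩ := hu'.exists_modification (w := w)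
    rw [← h3, ← h3']
    exact hmin μ' h1' (h2' ▸ hc')

end Costs

end RepairTheory

/-! ### The decision procedure -/

theorem DBTerm.finite_consts {V : Type} {n : ℕ} (t : DBTerm V n) : t.consts.Finite := by
  cases t <;> simp [DBTerm.consts]

theorem FOQuery.finite_consts {S : Schema} {V : Type} {n : ℕ} (φ : FOQuery S V n) :
    φ.consts.Finite := by
  induction φ with
  | atom R ts => exact Set.finite_iUnion fun i => (ts i).finite_consts
  | comp op s t => exact s.finite_consts.union t.finite_consts
  | not φ ih => exact ih
  | and φ ψ ih₁ ih₂ => exact ih₁.union ih₂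
  | all φ ih => exact ih

theorem Denial.finite_consts {S : Schema} {V : Type} (κ : Denial S V) : κ.consts.Finite := by
  have h1 : {v | ∃ a ∈ κ.atoms, ∃ i, v ∈ (a.2 i).consts}.Finite := by
    refine (κ.atoms.finite_toSet.biUnion (t := fun a => ⋃ i, (a.2 i).consts)
      fun a _ => Set.finite_iUnion fun i => (a.2 i).finite_consts).subset ?_
    rintro v ⟨a, ha, i, hv⟩
    exact Set.mem_biUnion ha (Set.mem_iUnion.2 ⟨i, hv⟩)
  have h2 : {v | ∃ c ∈ κ.comps, v ∈ c.2.1.consts ∨ v ∈ c.2.2.consts}.Finite := by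
    refine (κ.comps.finite_toSet.biUnion (t := fun c => c.2.1.consts ∪ c.2.2.consts)
      fun c _ => c.2.1.finite_consts.union c.2.2.finite_consts).subset ?_
    rintro v ⟨c, hc, hv⟩
    exact Set.mem_biUnion hc hv
  exact h1.union h2

theorem mainTheorem12 (S : Schema) {V : Type} [LinearOrder V] (enc : V ↪o List Bool)
    (IC : List (Denial S V)) (Q : BoolQuery S V)
    (dom : ∀ R : S.Rel, Fin (S.arity R) → Finset V)
    (w : ∀ R : S.Rel, Fin (S.arity R) → V → V → ℝ)
    (hw_pos : ∀ R A a b, b ∈ dom R A → a ≠ b → 0 < w R A a b)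
    (hw_out : ∀ R A a a' b, a ∉ dom R A → a' ∉ dom R A → b ∈ dom R A → w R A a b = w R A a' b)
    (m : ℕ) :
    InPTime (encodeInput (S := S) (IC := IC) (dom := dom) (m := m) enc) fun x =>
      ConsistentAnswerYes IC dom w Q (applyUpdates x.updates x.atoms.toFinset) := by
  obtain ⟨K, hK⟩ := exists_consistentAnswerYes_iff IC Q hw_pos hw_out m
  obtain ⟨C, hC⟩ : ∃ C : Finset V, (FOQuery.consts Q ⊆ C ∧ (∀ κ ∈ IC, κ.consts ⊆ C)) ∧
      ∀ R A, dom R A ⊆ C := by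
    have hfin : (FOQuery.consts Q ∪ (⋃ κ ∈ IC, κ.consts) ∪
        ⋃ R, ⋃ A, (dom R A : Set V)).Finite :=
      ((FOQuery.finite_consts Q).union
        (IC.finite_toSet.biUnion fun κ _ => κ.finite_consts)).union
        (Set.finite_iUnion fun R => Set.finite_iUnion fun A => (dom R A).finite_toSet)
    refine ⟨hfin.toFinset, ⟨fun v hv => ?_, fun κ hκ v hv => ?_⟩, fun R A v hv => ?_⟩
    · simp [hv]
    · rw [Set.Finite.coe_toFinset]
      exact .inl (.inr (Set.mem_biUnion hκ hv))
    · rw [Set.Finite.mem_toFinset]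
      exact .inr (Set.mem_iUnion.2 ⟨R, Set.mem_iUnion.2 ⟨A, hv⟩⟩)
  have hdef := DefInst.definableUpd (enc := enc) (C := C)
    (P := TrueAfterOptimalReplacements IC dom w Q K)
    (fun hF => hF.definable_trueAfterOptimalReplacements hw_out hC.1.2 hC.1.1 hC.2 K) m
    (defInst_atoms (ι := Empty) C)
  -- The two predicates agree because each input carries the consistency of `D`, the number of
  -- updates and the condition on the values they replace.
  have hfun : (fun x : IncrInput S V IC dom m => ConsistentAnswerYes IC dom w Q
      (applyUpdates x.updates x.atoms.toFinset)) = fun x =>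
      TrueAfterOptimalReplacements IC dom w Q K (applyUpdates x.updates x.atoms.toFinset) :=
    funext fun x => propext (hK _ _ x.consistent x.length_updates x.replaces_dom)
  rw [hfun]
  exact hdef.inPTime
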